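/- All graphs are finite, simple, undirected and have at least one vertex; $\overline G$ is the complement of $G$. An $a$-alternating sentence is a first order sentence about graphs, over adjacency and equality, in which negations occur only in front of relation symbols and every sequence of nested quantifiers has at most $a$ occurrences of $\exists\forall$ and $\forall\exists$. Let $D_0(G)$ be the minimum quantifier depth of a $0$-alternating sentence that is true on $G$ and false on every graph not isomorphic to $G$. A graph is complement-connected if both it and its complement are connected. A cocomponent of $G$ is an inclusion-maximal complement-connected induced subgraph of $G$. Let $\mathrm{Dec}_0\,G$ be the set of connected components of $G$, and let $\mathrm{Dec}_{i+1}\,G$ be the set of all connected components of the graphs $\overline F$ with $F\in\mathrm{Dec}_i\,G$. The rank of $G$ is defined inductively: $\mathrm{rk}\,G=0$ if $G$ is complement-connected; $\mathrm{rk}\,G=\mathrm{rk}\,\overline G$ if $G$ is connected but $\overline G$ is not; $\mathrm{rk}\,G=1+\max\{\mathrm{rk}\,F : F \text{ a connected component of } G\}$ if $G$ is disconnected. Let $G$ be connected and $k=\mathrm{rk}\,G$. Call $G$ uniform if $k=0$ or $\mathrm{Dec}_{k-1}\,G$ contains no complement-connected graph. Call $G$ inclusion-free if for every $0\le i\le k$: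 (1) for every $K\in\mathrm{Dec}_i\,G$, no two distinct connected components of $\overline K$ are isomorphic; (2) for all $K,M\in\mathrm{Dec}_i\,G$, either $K\cong M$ or neither of $K,M$ is isomorphic to an induced subgraph of the other. Main Lemma. Let $G$ be a connected, uniform, inclusion-free graph, let $c\ge 5$ be an integer, and suppose that every cocomponent of $G$ has at most $c$ vertices. Then $D_0(G)\le \mathrm{rk}\,G+c+1$. -/

import Mathlib

universe u

namespace LogicalDepth

/-! ### First order formulas about graphs, in negation normal form -/

/-- First order formulas over the vocabulary `∼` (adjacency) and `=`, in which negations occur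
only in front of relation symbols. `GraphFormula n` consists of the formulas whose free variables
are among `x₀, …, xₙ₋₁`; a quantifier in such a formula binds the variable `xₙ`. -/
inductive GraphFormula : ℕ → Type
  | adj {n : ℕ} (i j : Fin n) : GraphFormula n
  | notAdj {n : ℕ} (i j : Fin n) : GraphFormula n
  | eq {n : ℕ} (i j : Fin n) : GraphFormula n
  | ne {n : ℕ} (i j : Fin n) : GraphFormula n
  | and {n : ℕ} (φ ψ : GraphFormula n) : GraphFormula n
  | or {n : ℕ} (φ ψ : GraphFormula n) : GraphFormula n
  | ex {n : ℕ} (φ : GraphFormula (n + 1)) : GraphFormula n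
  | all {n : ℕ} (φ : GraphFormula (n + 1)) : GraphFormula n

namespace GraphFormula

/-- Truth of a formula in the graph `G`, under an assignment `v` of vertices to variables. -/
def Realize {V : Type u} (G : SimpleGraph V) : {n : ℕ} → GraphFormula n → (Fin n → V) → Prop
  | _, adj i j, v => G.Adj (v i) (v j)
  | _, notAdj i j, v => ¬ G.Adj (v i) (v j)
  | _, eq i j, v => v i = v j
  | _, ne i j, v => v i ≠ v j
  | _, and φ ψ, v => Realize G φ v ∧ Realize G ψ v
  | _, or φ ψ, v => Realize G φ v ∨ Realize G ψ v
  | _, ex φ, v => ∃ x : V, Realize G φ (Fin.snoc (α := fun _ => V) v x)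
  | _, all φ, v => ∀ x : V, Realize G φ (Fin.snoc (α := fun _ => V) v x)

/-- The quantifier depth: the maximum number of nested quantifiers. -/
def depth : {n : ℕ} → GraphFormula n → ℕ
  | _, adj _ _ => 0
  | _, notAdj _ _ => 0
  | _, eq _ _ => 0
  | _, ne _ _ => 0
  | _, and φ ψ => max (depth φ) (depth ψ)
  | _, or φ ψ => max (depth φ) (depth ψ)
  | _, ex φ => depth φ + 1
  | _, all φ => depth φ + 1

/-- The maximum number of occurrences of `∃∀` and `∀∃` in a sequence of nested quantifiers of the
formula, where the sequence is preceded by the quantifier `q`: `some true` stands for `∃`,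
`some false` for `∀`, and `none` for the absence of a preceding quantifier. -/
def alternationsFrom : {n : ℕ} → Option Bool → GraphFormula n → ℕ
  | _, _, adj _ _ => 0
  | _, _, notAdj _ _ => 0
  | _, _, eq _ _ => 0
  | _, _, ne _ _ => 0
  | _, q, and φ ψ => max (alternationsFrom q φ) (alternationsFrom q ψ)
  | _, q, or φ ψ => max (alternationsFrom q φ) (alternationsFrom q ψ)
  | _, q, ex φ => (if q = some false then 1 else 0) + alternationsFrom (some true) φ
  | _, q, all φ => (if q = some true then 1 else 0) + alternationsFrom (some false) φ

/-- The alternation number: the maximum number of quantifier alternations in a sequence of nested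
quantifiers. -/
def alternations {n : ℕ} (φ : GraphFormula n) : ℕ := alternationsFrom none φ

/-- The sentence `φ` is true in the graph `G`. -/
def Holds (φ : GraphFormula 0) {V : Type u} (G : SimpleGraph V) : Prop :=
  φ.Realize G Fin.elim0

/-- The sentence `φ` defines `G` up to isomorphism: it is true in `G` and false in every graph that
is not isomorphic to `G`. All graphs are finite and have at least one vertex. -/
def Defines (φ : GraphFormula 0) {V : Type u} (G : SimpleGraph V) : Prop :=
  φ.Holds G ∧ ∀ (W : Type u) [Finite W] [Nonempty W] (H : SimpleGraph W),
    ¬ Nonempty (G ≃g H) → ¬ φ.Holds H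

end GraphFormula

/-- `D_a(G)`: the minimum quantifier depth of an `a`-alternating sentence that defines `G` (and `⊤`
if there were none). -/
noncomputable def altDepth (a : ℕ) {V : Type u} (G : SimpleGraph V) : ℕ∞ :=
  ⨅ φ ∈ {φ : GraphFormula 0 | φ.alternations ≤ a ∧ φ.Defines G}, (φ.depth : ℕ∞)

/-! ### Decompositions, cocomponents and rank -/

/-- A graph is complement-connected if it and its complement are connected. -/
def CompConnected {V : Type u} (G : SimpleGraph V) : Prop :=
  G.Connected ∧ Gᶜ.Connected

/-- `S` is the vertex set of a cocomponent of `G`, that is, of an inclusion-maximal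
complement-connected induced subgraph. -/
def IsCocomponent {V : Type u} (G : SimpleGraph V) (S : Set V) : Prop :=
  Maximal (fun T : Set V => CompConnected (G.induce T)) S

/-- The vertex sets of the connected components of the graph `F` induces on `S`. -/
def componentSets {V : Type u} (F : SimpleGraph V) (S : Set V) : Set (Set V) :=
  {T | ∃ C : (F.induce S).ConnectedComponent, T = Subtype.val '' C.supp}

/-- The graph `G` complemented `i` times. -/
def level {V : Type u} (G : SimpleGraph V) : ℕ → SimpleGraph V
  | 0 => G
  | i + 1 => (level G i)ᶜ

/-- The vertex sets of the members of the depth `i` decomposition `Dec_i G`, where `Dec_0 G` is the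
set of connected components of `G` and `Dec_{i+1} G` consists of the connected components of the
complements of the members of `Dec_i G`. The member with vertex set `S` is `decGraph G i S`. -/
def decSets {V : Type u} (G : SimpleGraph V) : ℕ → Set (Set V)
  | 0 => componentSets G Set.univ
  | i + 1 => ⋃ S ∈ decSets G i, componentSets (level G (i + 1)) S

/-- The member of `Dec_i G` with vertex set `S`. The complement of `decGraph G i S` is
`decGraph G (i + 1) S`. -/
abbrev decGraph {V : Type u} (G : SimpleGraph V) (i : ℕ) (S : Set V) : SimpleGraph S :=
  (level G i).induce S

open Classical in
/-- The rank of a finite graph: `0` for a complement-connected graph, the rank of the complement for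
any other connected graph, and one more than the maximum rank of a connected component for a
disconnected graph. -/
noncomputable def rk {V : Type u} [Finite V] (G : SimpleGraph V) : ℕ :=
  if _h : G.Connected then
    if _h' : Gᶜ.Connected then 0 else rk Gᶜ
  else 1 + ⨆ C : G.ConnectedComponent, rk C.toSimpleGraph
termination_by 2 * Nat.card V + (if G.Connected then 1 else 0)
decreasing_by
  · simp [*]
  · have hlt : Nat.card C < Nat.card V := by
      refine Set.ncard_lt_card (s := C.supp) ?_
      intro hC
      refine _h ?_
      obtain ⟨v, _⟩ := C.exists_rep
      have : Nonempty V := ⟨v⟩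
      refine ⟨fun x y => ?_⟩
      have hx : x ∈ C.supp := hC ▸ Set.mem_univ x
      have hy : y ∈ C.supp := hC ▸ Set.mem_univ y
      rw [SimpleGraph.ConnectedComponent.mem_supp_iff] at hx hy
      exact SimpleGraph.ConnectedComponent.exact (hx.trans hy.symm)
    split_ifs <;> omega

/-- A (connected) graph `G` of rank `k` is uniform if `Dec_{k-1} G` contains no complement-connected
graph, that is, no cocomponent appears before `Dec_k G`; for `k = 0` there is no condition. -/
def IsUniform {V : Type u} [Finite V] (G : SimpleGraph V) : Prop :=
  ∀ i : ℕ, i + 1 = rk G → ∀ S ∈ decSets G i, ¬ CompConnected (decGraph G i S)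

/-- A (connected) graph `G` of rank `k` is inclusion-free if, for `0 ≤ i ≤ k`, the complement of a
member of `Dec_i G` has no two isomorphic connected components, and no member of `Dec_i G` is
isomorphic to an induced subgraph of a member that is not isomorphic to it. -/
def IsInclusionFree {V : Type u} [Finite V] (G : SimpleGraph V) : Prop :=
  ∀ i ≤ rk G,
    (∀ K ∈ decSets G i, ∀ C C' : (decGraph G i K)ᶜ.ConnectedComponent,
      Nonempty (C.toSimpleGraph ≃g C'.toSimpleGraph) → C = C') ∧
    (∀ K ∈ decSets G i, ∀ M ∈ decSets G i,
      (decGraph G i K).IsIndContained (decGraph G i M) →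
        Nonempty (decGraph G i K ≃g decGraph G i M))

end LogicalDepth

/-! Fix a graph `H` not isomorphic to `G`. Surviving a fixed number of rounds, with Spoiler confined
to `G`, is expressed by an existential sentence built from `G`; with Spoiler confined to `H`, by a
universal one. Their conjunction is 0-alternating, so it suffices that Spoiler wins one of these two
games within `rk G + c + 1` rounds (`altDepth_zero_le`).

The decomposition is a decreasing sequence of equivalence relations `decRel`, with `Dec_i` given by
the classes of index `i + 1`; the final pieces have index `K = rk G + 1`. Vertices separated exactly
at step `i` are adjacent iff `i` is odd, so Duplicator can shift a separation only by an even
amount. If she shifts it to an earlier step, Spoiler plays a vertex separated at a step strictly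
between, of the other parity. This forces another early separation, and iterating defeats her
(`not_survives_of_early_separation`). She must therefore respect the pieces.

Complement-connected sets are never split by the decomposition, so their answers stay within one
piece. Spoiler can thus exploit a piece that does not embed into its counterpart: he descends
through components that embed into no component opposite, and finally plays a whole final piece, of
at most `c` vertices (`not_survives_of_not_emb`).

It remains to find such a piece. Consider the greatest depth at which a piece of `G` embeds properly
into a piece of `H`. If there is none, `G` does not embed into `H`, and Spoiler descends in `G`. If
the depth is `K`, he plays in `H`, on a set that overfills a final piece of `G` or on a copy of one
(`Layered.not_survives_of_top`). At smaller depth the copy consists of whole components of the piece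
of `H`, and he starts with a vertex of that piece outside the copy (`Layered.not_survives_of_lt`).
-/

namespace LogicalDepth

/-! ### The game in which Spoiler plays in one graph only -/

/-- The pairs in `P` form a partial isomorphism between `G` and `H`. -/
def Consistent {V W : Type*} (G : SimpleGraph V) (H : SimpleGraph W) (P : Set (V × W)) : Prop :=
  ∀ p ∈ P, ∀ q ∈ P, (p.1 = q.1 ↔ p.2 = q.2) ∧ (G.Adj p.1 q.1 ↔ H.Adj p.2 q.2)

/-- Duplicator survives `r` rounds from position `P` if Spoiler always plays in `G`. -/
def Survives {V W : Type*} (G : SimpleGraph V) (H : SimpleGraph W) : ℕ → Set (V × W) → Prop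
  | 0, P => Consistent G H P
  | r + 1, P => Consistent G H P ∧ ∀ a, ∃ b, Survives G H r (insert (a, b) P)

section Game

variable {V W : Type*} {G : SimpleGraph V} {H : SimpleGraph W}

theorem Consistent.mono {P Q : Set (V × W)} (h : Consistent G H Q) (hPQ : P ⊆ Q) :
    Consistent G H P := fun p hp q hq => h p (hPQ hp) q (hPQ hq)

theorem Survives.consistent {r : ℕ} {P : Set (V × W)} (h : Survives G H r P) :
    Consistent G H P := by
  cases r with
  | zero => exact h
  | succ r => exact h.1

theorem Survives.mono {r s : ℕ} {P Q : Set (V × W)} (h : Survives G H r Q) (hsr : s ≤ r)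
    (hPQ : P ⊆ Q) : Survives G H s P := by
  induction s generalizing r P Q with
  | zero => exact h.consistent.mono hPQ
  | succ s ih =>
    obtain ⟨r, rfl⟩ : ∃ r', r = r' + 1 := ⟨r - 1, by omega⟩
    refine ⟨h.1.mono hPQ, fun a => ?_⟩
    obtain ⟨b, hb⟩ := h.2 a
    exact ⟨b, ih hb (by omega) (Set.insert_subset_insert hPQ)⟩

theorem Survives.play {r s : ℕ} {P : Set (V × W)} (h : Survives G H r P) (hs : s + 1 ≤ r) (a : V) :
    ∃ b, Survives G H s (insert (a, b) P) := by
  obtain ⟨r, rfl⟩ : ∃ r', r = r' + 1 := ⟨r - 1, by omega⟩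
  obtain ⟨b, hb⟩ := h.2 a
  exact ⟨b, hb.mono (by omega) subset_rfl⟩

theorem Survives.play_set [Finite V] [Nonempty W] {r s : ℕ} {P : Set (V × W)} (S : Set V)
    (h : Survives G H r P) (hs : s + S.ncard ≤ r) :
    ∃ f : V → W, Survives G H s (P ∪ (fun x => (x, f x)) '' S) := by
  classical
  induction S, S.toFinite using Set.Finite.induction_on generalizing r s with
  | empty => exact ⟨fun _ => Classical.arbitrary W, by simpa using h.mono (by simpa using hs) subset_rfl⟩
  | @insert a S ha hS ih =>
    rw [Set.ncard_insert_of_notMem ha hS] at hs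
    obtain ⟨f, hf⟩ := ih (s := s + 1) h (by omega)
    obtain ⟨b, hb⟩ := hf.play le_rfl a
    refine ⟨Function.update f a b, hb.mono le_rfl ?_⟩
    rintro p (hp | ⟨x, hx, rfl⟩)
    · exact Or.inr (Or.inl hp)
    · by_cases hxa : x = a
      · subst hxa; simp
      · have hx' : x ∈ S := by simpa [hxa] using hx
        right; right
        exact ⟨x, hx', by simp [hxa]⟩

end Game

/-! ### Formulas expressing survival in the one-sided games -/

namespace GraphFormula

/-- The conjunction of `φ` and the members of `l`. -/
def bigAnd {n : ℕ} (φ : GraphFormula n) (l : List (GraphFormula n)) : GraphFormula n :=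
  l.foldr .and φ

/-- The disjunction of `φ` and the members of `l`. -/
def bigOr {n : ℕ} (φ : GraphFormula n) (l : List (GraphFormula n)) : GraphFormula n :=
  l.foldr .or φ

section Big

variable {n : ℕ} (φ : GraphFormula n) (l : List (GraphFormula n))

theorem realize_bigAnd {V : Type*} (G : SimpleGraph V) (v : Fin n → V) :
    (bigAnd φ l).Realize G v ↔ φ.Realize G v ∧ ∀ ψ ∈ l, ψ.Realize G v := by
  induction l with
  | nil => simp [bigAnd]
  | cons a l ih =>
    change (a.Realize G v ∧ (bigAnd φ l).Realize G v) ↔ _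
    rw [ih]; simp only [List.mem_cons, forall_eq_or_imp]; tauto

theorem realize_bigOr {V : Type*} (G : SimpleGraph V) (v : Fin n → V) :
    (bigOr φ l).Realize G v ↔ φ.Realize G v ∨ ∃ ψ ∈ l, ψ.Realize G v := by
  induction l with
  | nil => simp [bigOr]
  | cons a l ih =>
    change (a.Realize G v ∨ (bigOr φ l).Realize G v) ↔ _
    rw [ih]; simp only [List.mem_cons, exists_eq_or_imp]; tauto

theorem depth_bigAnd {d : ℕ} (h : φ.depth ≤ d) (hl : ∀ ψ ∈ l, ψ.depth ≤ d) :
    (bigAnd φ l).depth ≤ d := by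
  induction l with
  | nil => exact h
  | cons a l ih =>
    exact max_le (hl a (by simp)) (ih fun ψ hψ => hl ψ (by simp [hψ]))

theorem depth_bigOr {d : ℕ} (h : φ.depth ≤ d) (hl : ∀ ψ ∈ l, ψ.depth ≤ d) :
    (bigOr φ l).depth ≤ d := by
  induction l with
  | nil => exact h
  | cons a l ih =>
    exact max_le (hl a (by simp)) (ih fun ψ hψ => hl ψ (by simp [hψ]))

theorem alternationsFrom_bigAnd {q : Option Bool} (h : φ.alternationsFrom q = 0)
    (hl : ∀ ψ ∈ l, ψ.alternationsFrom q = 0) : (bigAnd φ l).alternationsFrom q = 0 := by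
  induction l with
  | nil => exact h
  | cons a l ih =>
    change max (a.alternationsFrom q) ((bigAnd φ l).alternationsFrom q) = 0
    rw [hl a (by simp), ih fun ψ hψ => hl ψ (by simp [hψ])]; rfl

theorem alternationsFrom_bigOr {q : Option Bool} (h : φ.alternationsFrom q = 0)
    (hl : ∀ ψ ∈ l, ψ.alternationsFrom q = 0) : (bigOr φ l).alternationsFrom q = 0 := by
  induction l with
  | nil => exact h
  | cons a l ih =>
    change max (a.alternationsFrom q) ((bigOr φ l).alternationsFrom q) = 0
    rw [hl a (by simp), ih fun ψ hψ => hl ψ (by simp [hψ])]; rfl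

end Big

section Hintikka

variable {V : Type*} (G : SimpleGraph V)

open Classical in
/-- The literals about `xᵢ` and `xⱼ` that hold in `G` at `v`. -/
noncomputable def literal {n : ℕ} (v : Fin n → V) (p : Fin n × Fin n) : GraphFormula n :=
  .and (if G.Adj (v p.1) (v p.2) then .adj p.1 p.2 else .notAdj p.1 p.2)
    (if v p.1 = v p.2 then .eq p.1 p.2 else .ne p.1 p.2)

/-- The quantifier-free type of the tuple `v` in `G`. -/
noncomputable def diagram {n : ℕ} (v : Fin (n + 1) → V) : GraphFormula (n + 1) :=
  -- There is no truth constant, so the conjunction starts from `x₀ = x₀`; this needs at least one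
  -- variable.
  bigAnd (.eq 0 0) (Finset.univ.toList.map (literal G v))

theorem depth_literal {n : ℕ} (v : Fin n → V) (p : Fin n × Fin n) : (literal G v p).depth = 0 := by
  unfold literal; split_ifs <;> rfl

theorem alternationsFrom_literal {n : ℕ} (v : Fin n → V) (p : Fin n × Fin n) (q : Option Bool) :
    (literal G v p).alternationsFrom q = 0 := by
  unfold literal; split_ifs <;> rfl

theorem depth_diagram {n : ℕ} (v : Fin (n + 1) → V) : (diagram G v).depth ≤ 0 := by
  refine depth_bigAnd _ _ (by simp [depth]) ?_
  simp only [List.forall_mem_map, depth_literal, le_refl, implies_true]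

theorem alternationsFrom_diagram {n : ℕ} (v : Fin (n + 1) → V) (q : Option Bool) :
    (diagram G v).alternationsFrom q = 0 := by
  refine alternationsFrom_bigAnd _ _ (by simp [alternationsFrom]) ?_
  simp only [List.forall_mem_map, alternationsFrom_literal, implies_true]

theorem realize_literal {W : Type*} (H : SimpleGraph W) {n : ℕ} (v : Fin n → V) (w : Fin n → W)
    (p : Fin n × Fin n) : (literal G v p).Realize H w ↔
      (v p.1 = v p.2 ↔ w p.1 = w p.2) ∧ (G.Adj (v p.1) (v p.2) ↔ H.Adj (w p.1) (w p.2)) := by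
  unfold literal; split_ifs <;> simp_all [Realize, and_comm]

theorem realize_diagram {W : Type*} (H : SimpleGraph W) {n : ℕ} (v : Fin (n + 1) → V)
    (w : Fin (n + 1) → W) : (diagram G v).Realize H w ↔
      Consistent G H (Set.range fun i => (v i, w i)) := by
  unfold diagram
  rw [realize_bigAnd]
  simp only [Realize, List.forall_mem_map, realize_literal, Consistent, Set.forall_mem_range,
    Finset.mem_toList, Finset.mem_univ, true_and, forall_const, Prod.forall]

theorem range_snoc {W : Type*} {n : ℕ} (v : Fin n → V) (w : Fin n → W) (a : V) (b : W) :
    (Set.range fun i => (Fin.snoc (α := fun _ => V) v a i, Fin.snoc (α := fun _ => W) w b i)) =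
      insert (a, b) (Set.range fun i => (v i, w i)) := by
  ext p
  constructor
  · rintro ⟨i, rfl⟩
    refine Fin.lastCases ?_ (fun j => ?_) i
    · left; simp
    · right; exact ⟨j, by simp⟩
  · rintro (rfl | ⟨j, rfl⟩)
    · exact ⟨Fin.last n, by simp⟩
    · exact ⟨j.castSucc, by simp⟩

theorem realize_diagram' {W : Type*} (H : SimpleGraph W) {n : ℕ} (v : Fin (n + 1) → V)
    (w : Fin (n + 1) → W) : (diagram G v).Realize H w ↔
      Consistent H G (Set.range fun i => (w i, v i)) := by
  rw [realize_diagram]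
  simp only [Consistent, Set.forall_mem_range]
  constructor <;> intro h i j <;> exact ⟨(h i j).1.symm, (h i j).2.symm⟩

theorem survives_refl (r : ℕ) (P : Set (V × V)) (hP : ∀ p ∈ P, p.1 = p.2) : Survives G G r P := by
  have hc : Consistent G G P := fun p hp q hq => by simp [hP p hp, hP q hq]
  induction r generalizing P with
  | zero => exact hc
  | succ r ih =>
    refine ⟨hc, fun a => ⟨a, ?_⟩⟩
    have : ∀ p ∈ insert (a, a) P, p.1 = p.2 := by
      rintro p (rfl | hp)
      exacts [rfl, hP p hp]
    exact ih _ this fun p hp q hq => by simp [this p hp, this q hq]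

variable [Fintype V]

/-- The existential type of rank `r` of `v` in `G`. -/
noncomputable def exType : ℕ → {n : ℕ} → (Fin (n + 1) → V) → GraphFormula (n + 1)
  | 0, _, v => diagram G v
  | r + 1, _, v => bigAnd (diagram G v)
      (Finset.univ.toList.map fun a => .ex (exType r (Fin.snoc (α := fun _ => V) v a)))

/-- The universal type of rank `r` of `v` in `G`. -/
noncomputable def allType [Nonempty V] : ℕ → {n : ℕ} → (Fin (n + 1) → V) → GraphFormula (n + 1)
  | 0, _, v => diagram G v
  | r + 1, _, v => .and (diagram G v) (.all
      (bigOr (allType r (Fin.snoc (α := fun _ => V) v (Classical.arbitrary V)))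
        (Finset.univ.toList.map fun a => allType r (Fin.snoc (α := fun _ => V) v a))))

theorem realize_exType {W : Type*} (H : SimpleGraph W) (r : ℕ) {n : ℕ} (v : Fin (n + 1) → V)
    (w : Fin (n + 1) → W) : (exType G r v).Realize H w ↔
      Survives G H r (Set.range fun i => (v i, w i)) := by
  induction r generalizing n with
  | zero => exact realize_diagram G H v w
  | succ r ih =>
    simp only [exType, realize_bigAnd, realize_diagram, Survives, List.mem_map, Finset.mem_toList,
      Finset.mem_univ, true_and, forall_exists_index, forall_apply_eq_imp_iff, Realize, ih,
      range_snoc]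

theorem realize_allType [Nonempty V] {W : Type*} (H : SimpleGraph W) (r : ℕ) {n : ℕ}
    (v : Fin (n + 1) → V) (w : Fin (n + 1) → W) : (allType G r v).Realize H w ↔
      Survives H G r (Set.range fun i => (w i, v i)) := by
  induction r generalizing n with
  | zero => exact realize_diagram' G H v w
  | succ r ih =>
    simp only [allType, realize_bigOr, realize_diagram', Survives, List.mem_map, Finset.mem_toList,
      Finset.mem_univ, true_and, exists_exists_eq_and, Realize, ih, range_snoc]
    refine and_congr_right fun _ => forall_congr' fun b => ?_
    constructor
    · rintro (h | h)
      exacts [⟨_, h⟩, h]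
    · exact Or.inr

theorem depth_exType (r : ℕ) {n : ℕ} (v : Fin (n + 1) → V) : (exType G r v).depth ≤ r := by
  induction r generalizing n with
  | zero => exact depth_diagram G v
  | succ r ih =>
    refine depth_bigAnd _ _ ((depth_diagram G v).trans (Nat.zero_le _)) ?_
    simp [depth, ih]

theorem depth_allType [Nonempty V] (r : ℕ) {n : ℕ} (v : Fin (n + 1) → V) :
    (allType G r v).depth ≤ r := by
  induction r generalizing n with
  | zero => exact depth_diagram G v
  | succ r ih =>
    refine max_le ((depth_diagram G v).trans (Nat.zero_le _)) (Nat.succ_le_succ ?_)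
    exact depth_bigOr _ _ (ih _) (by simp [ih])

theorem alternationsFrom_exType (r : ℕ) {n : ℕ} (v : Fin (n + 1) → V) {q : Option Bool}
    (hq : q ≠ some false) : (exType G r v).alternationsFrom q = 0 := by
  induction r generalizing n q with
  | zero => exact alternationsFrom_diagram G v q
  | succ r ih =>
    refine alternationsFrom_bigAnd _ _ (alternationsFrom_diagram G v q) ?_
    simp [alternationsFrom, ih, hq]

theorem alternationsFrom_allType [Nonempty V] (r : ℕ) {n : ℕ} (v : Fin (n + 1) → V)
    {q : Option Bool} (hq : q ≠ some true) : (allType G r v).alternationsFrom q = 0 := by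
  induction r generalizing n q with
  | zero => exact alternationsFrom_diagram G v q
  | succ r ih =>
    simp only [allType, alternationsFrom, alternationsFrom_diagram, hq, if_false]
    rw [alternationsFrom_bigOr _ _ (ih _ (by simp)) (by simp [ih])]; rfl

end Hintikka

end GraphFormula

open GraphFormula in
/-- If every other graph is distinguished from `G` in `r + 1` rounds in the game in which Spoiler
plays only in one graph, then `r + 1` bounds the depth of `0`-alternating definitions. -/
theorem altDepth_zero_le {V : Type u} [Finite V] [Nonempty V] (G : SimpleGraph V) (r : ℕ)
    (h : ∀ (W : Type u) [Finite W] [Nonempty W] (H : SimpleGraph W), ¬ Nonempty (G ≃g H) →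
      Survives G H (r + 1) ∅ → Survives H G (r + 1) ∅ → False) :
    altDepth 0 G ≤ ((r + 1 : ℕ) : ℕ∞) := by
  have := Fintype.ofFinite V
  let s (a : V) : Fin 1 → V := Fin.snoc (α := fun _ => V) Fin.elim0 a
  let φ₁ (a : V) : GraphFormula 0 := .ex (exType G r (s a))
  let a₀ := Classical.arbitrary V
  -- The first conjunct describes the game played in `G`, the second the game played in the other
  -- graph. The repeated `a₀` only seeds the folds.
  let φ : GraphFormula 0 := .and (bigAnd (φ₁ a₀) (Finset.univ.toList.map φ₁))
    (.all (bigOr (allType G r (s a₀)) (Finset.univ.toList.map fun a => allType G r (s a))))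
  have hφ : ∀ {W : Type u} (H : SimpleGraph W), φ.Holds H ↔
      Survives G H (r + 1) ∅ ∧ Survives H G (r + 1) ∅ := by
    intro W H
    have h₁ : ∀ a, (φ₁ a).Realize H Fin.elim0 ↔ ∃ b, Survives G H r (insert (a, b) ∅) := by
      intro a
      simp only [φ₁, s, Realize, realize_exType, range_snoc, Set.range_eq_empty]
    have h₂ : ∀ a b, (allType G r (s a)).Realize H (Fin.snoc (α := fun _ => W) Fin.elim0 b) ↔
        Survives H G r (insert (b, a) ∅) := by
      intro a b
      simp only [s, realize_allType, range_snoc, Set.range_eq_empty]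
    have e₁ : Consistent G H ∅ := by simp [Consistent]
    have e₂ : Consistent H G ∅ := by simp [Consistent]
    simp only [Holds, φ, Realize, realize_bigAnd, realize_bigOr, h₁, List.mem_map,
      Finset.mem_toList, Finset.mem_univ, true_and, forall_exists_index, forall_apply_eq_imp_iff,
      exists_exists_eq_and, h₂, Survives, e₁, e₂]
    refine and_congr ⟨fun h => h.2, fun h => ⟨h _, h⟩⟩ (forall_congr' fun b => ?_)
    exact ⟨fun h => h.elim (fun h => ⟨_, h⟩) id, Or.inr⟩
  have hmem : φ ∈ {φ : GraphFormula 0 | φ.alternations ≤ 0 ∧ φ.Defines G} := by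
    refine ⟨?_, ?_, ?_⟩
    · have e : (bigAnd (φ₁ a₀) (Finset.univ.toList.map φ₁)).alternationsFrom none = 0 :=
        alternationsFrom_bigAnd _ _
          (by simp [φ₁, alternationsFrom, alternationsFrom_exType])
          (by simp [φ₁, alternationsFrom, alternationsFrom_exType])
      simp only [alternations, φ, alternationsFrom, e]
      rw [alternationsFrom_bigOr _ _ (alternationsFrom_allType _ _ _ (by simp))
        (by simp [alternationsFrom_allType])]
      simp
    · exact (hφ G).2 ⟨survives_refl G _ _ (by simp), survives_refl G _ _ (by simp)⟩
    · intro W _ _ H hH hh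
      exact h W H hH ((hφ H).1 hh).1 ((hφ H).1 hh).2
  refine (iInf₂_le φ hmem).trans ?_
  have : φ.depth ≤ r + 1 := by
    refine max_le (depth_bigAnd _ _ (Nat.succ_le_succ (depth_exType G r _)) ?_)
      (Nat.succ_le_succ (depth_bigOr _ _ (depth_allType G r _) ?_))
    · simp [φ₁, depth, depth_exType]
    · simp [depth_allType]
  exact_mod_cast this

/-! ### Connectedness in terms of cuts -/

/-- The subgraph of `F` induced on `S` is preconnected, in terms of cuts. -/
def CutConn {V : Type*} (F : SimpleGraph V) (S : Set V) : Prop :=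
  ∀ T : Set V, (∃ x ∈ S, x ∈ T) → (∃ y ∈ S, y ∉ T) → ∃ x ∈ S, x ∈ T ∧ ∃ y ∈ S, y ∉ T ∧ F.Adj x y

theorem exists_step_of_reflTransGen {α : Type*} {r : α → α → Prop} {T : Set α} {x y : α}
    (h : Relation.ReflTransGen r x y) (hx : x ∈ T) (hy : y ∉ T) :
    ∃ u ∈ T, ∃ v ∉ T, Relation.ReflTransGen r x u ∧ r u v := by
  induction h with
  | refl => exact absurd hx hy
  | @tail b c hb hbc ih =>
    by_cases hbT : b ∈ T
    · exact ⟨b, hbT, c, hy, hb, hbc⟩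
    · exact ih hbT

theorem cutConn_iff_preconnected {V : Type*} (F : SimpleGraph V) (S : Set V) :
    CutConn F S ↔ (F.induce S).Preconnected := by
  constructor
  · intro h x y
    by_contra hxy
    obtain ⟨u, hu, hxu, v, hv, hxv, huv⟩ := h (Subtype.val '' {z | (F.induce S).Reachable x z})
      ⟨x, x.2, x, SimpleGraph.Reachable.refl x, rfl⟩
      ⟨y, y.2, by rintro ⟨z, hz, hzy⟩; rw [Subtype.ext hzy] at hz; exact hxy hz⟩
    obtain ⟨u', hu', rfl⟩ := hxu
    refine hxv ⟨⟨v, hv⟩, ?_, rfl⟩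
    exact SimpleGraph.Reachable.trans hu' (SimpleGraph.Adj.reachable huv)
  · rintro h T ⟨x, hxS, hxT⟩ ⟨y, hyS, hyT⟩
    have := (SimpleGraph.reachable_iff_reflTransGen _ _).1 (h ⟨x, hxS⟩ ⟨y, hyS⟩)
    obtain ⟨u, hu, v, hv, -, huv⟩ := exists_step_of_reflTransGen (T := Subtype.val ⁻¹' T) this hxT hyT
    exact ⟨u, u.2, hu, v, v.2, hv, huv⟩

theorem compl_induce {V : Type*} (F : SimpleGraph V) (S : Set V) :
    (F.induce S)ᶜ = Fᶜ.induce S := by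
  ext x y
  simp [SimpleGraph.compl_adj, Subtype.ext_iff]

theorem compConnected_induce_iff {V : Type*} (F : SimpleGraph V) (S : Set V) :
    CompConnected (F.induce S) ↔ S.Nonempty ∧ CutConn F S ∧ CutConn Fᶜ S := by
  rw [CompConnected, compl_induce, SimpleGraph.connected_iff, SimpleGraph.connected_iff,
    cutConn_iff_preconnected, cutConn_iff_preconnected, Set.nonempty_coe_sort]
  tauto

/-! ### The decomposition as a sequence of equivalence relations -/

section Dec

variable {V : Type*} (G : SimpleGraph V)

theorem level_add_two (i : ℕ) : level G (i + 2) = level G i := compl_compl _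

theorem level_adj {x y : V} (hxy : x ≠ y) (i : ℕ) :
    (level G i).Adj x y ↔ (Odd i ↔ ¬ G.Adj x y) := by
  induction i with
  | zero => simp [level]
  | succ i ih =>
    simp only [level, SimpleGraph.compl_adj, ih, Nat.odd_add_one, ne_eq, hxy, not_false_iff]
    tauto

/-- `x` and `y` lie in the same member of the decomposition of `G` of depth `i - 1`; for `i = 0`
this is no condition. -/
def decRel : ℕ → V → V → Prop
  | 0 => fun _ _ => True
  | i + 1 => Relation.ReflTransGen fun x y => decRel i x y ∧ (level G i).Adj x y

/-- The class of `a` under `decRel G i`. -/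
def cls (i : ℕ) (a : V) : Set V := {x | decRel G i a x}

variable {G}

theorem decRel_refl (i : ℕ) (x : V) : decRel G i x x := by
  cases i with
  | zero => trivial
  | succ i => exact .refl

theorem decRel_symm {i : ℕ} {x y : V} (h : decRel G i x y) : decRel G i y x := by
  induction i generalizing x y with
  | zero => trivial
  | succ i ih =>
    have : Std.Symm fun x y => decRel G i x y ∧ (level G i).Adj x y :=
      ⟨fun a b hab => ⟨ih hab.1, hab.2.symm⟩⟩
    exact Relation.ReflTransGen.stdSymm.symm _ _ h

theorem decRel_trans {i : ℕ} {x y z : V} (h : decRel G i x y) (h' : decRel G i y z) :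
    decRel G i x z := by
  cases i with
  | zero => trivial
  | succ i => exact Relation.ReflTransGen.trans h h'

theorem decRel_of_succ {i : ℕ} {x y : V} (h : decRel G (i + 1) x y) : decRel G i x y := by
  change Relation.ReflTransGen _ x y at h
  induction h with
  | refl => exact decRel_refl i x
  | tail _ h ih => exact decRel_trans ih h.1

theorem decRel_of_le {i j : ℕ} (hij : i ≤ j) {x y : V} (h : decRel G j x y) : decRel G i x y := by
  induction j, hij using Nat.le_induction with
  | base => exact h
  | succ j _ ih => exact ih (decRel_of_succ h)

theorem cls_eq {i : ℕ} {x y : V} (h : decRel G i x y) : cls G i x = cls G i y :=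
  Set.ext fun _ => ⟨decRel_trans (decRel_symm h), decRel_trans h⟩

theorem self_mem_cls (i : ℕ) (x : V) : x ∈ cls G i x := decRel_refl i x

theorem cls_subset {i j : ℕ} (hij : i ≤ j) (x : V) : cls G j x ⊆ cls G i x :=
  fun _ h => decRel_of_le hij h

theorem cls_zero (x : V) : cls G 0 x = Set.univ := Set.eq_univ_of_forall fun _ => trivial

theorem decRel_succ_of_adj {i : ℕ} {x y : V} (h : decRel G i x y) (h' : (level G i).Adj x y) :
    decRel G (i + 1) x y := .single ⟨h, h'⟩

theorem ne_of_not_decRel {i : ℕ} {x y : V} (h : ¬ decRel G i x y) : x ≠ y :=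
  fun e => h (e ▸ decRel_refl i x)

/-- Vertices that are separated by the `i`th decomposition step are adjacent iff `i` is odd. -/
theorem adj_iff_odd {i : ℕ} {x y : V} (h : decRel G i x y) (h' : ¬ decRel G (i + 1) x y) :
    G.Adj x y ↔ Odd i := by
  have := (level_adj G (ne_of_not_decRel h') i).not.1 fun hadj => h' (decRel_succ_of_adj h hadj)
  tauto

theorem cutConn_cls (i : ℕ) (a : V) : CutConn (level G i) (cls G (i + 1) a) := by
  rintro T ⟨x, hx, hxT⟩ ⟨y, hy, hyT⟩
  have hxy : decRel G (i + 1) x y := decRel_trans (decRel_symm hx) hy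
  obtain ⟨u, hu, v, hv, hxu, huv⟩ := exists_step_of_reflTransGen hxy hxT hyT
  have hau : decRel G (i + 1) a u := decRel_trans hx hxu
  exact ⟨u, hau, hu, v, decRel_trans hau (.single huv), hv, huv.2⟩

theorem subset_cls_succ {i : ℕ} {a : V} {S : Set V} (hS : CutConn (level G i) S) (ha : a ∈ S)
    (h : S ⊆ cls G i a) : S ⊆ cls G (i + 1) a := by
  by_contra hn
  obtain ⟨y, hy, hy'⟩ := Set.not_subset.1 hn
  obtain ⟨u, hu, hu', v, hv, hv', huv⟩ := hS (cls G (i + 1) a) ⟨a, ha, self_mem_cls _ _⟩ ⟨y, hy, hy'⟩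
  exact hv' (decRel_trans hu' (decRel_succ_of_adj (decRel_trans (decRel_symm (h hu)) (h hv)) huv))

/-- The set `S` induces a complement-connected (or empty) subgraph. -/
def CutCC (G : SimpleGraph V) (S : Set V) : Prop := CutConn G S ∧ CutConn Gᶜ S

theorem CutCC.level {S : Set V} (h : CutCC G S) (i : ℕ) : CutConn (level G i) S := by
  induction i using Nat.twoStepInduction with
  | zero => exact h.1
  | one => exact h.2
  | more i ih _ => rwa [level_add_two]

theorem cutCC_of_levels {S : Set V} {i : ℕ} (h : CutConn (LogicalDepth.level G i) S)
    (h' : CutConn (LogicalDepth.level G (i + 1)) S) : CutCC G S := by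
  induction i using Nat.twoStepInduction with
  | zero => exact ⟨h, h'⟩
  | one => exact ⟨by rwa [show LogicalDepth.level G (1 + 1) = G from level_add_two G 0] at h', h⟩
  | more i ih _ =>
    rw [level_add_two] at h
    rw [show i + 2 + 1 = (i + 1) + 2 from rfl, level_add_two] at h'
    exact ih h h'

/-- Each step takes components in `G` or in its complement, and `S` is connected in both. -/
theorem CutCC.subset_cls {S : Set V} (h : CutCC G S) {a : V} (ha : a ∈ S) (i : ℕ) :
    S ⊆ cls G i a := by
  induction i with
  | zero => simp [cls_zero]
  | succ i ih => exact subset_cls_succ (h.level i) ha ih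

/-- A class that the next step leaves whole is connected at two consecutive levels, hence in `G` and
in its complement. -/
theorem cutCC_cls_of_eq {i : ℕ} {a : V} (h : cls G (i + 1) a ⊆ cls G (i + 2) a) :
    CutCC G (cls G (i + 1) a) := by
  refine cutCC_of_levels (cutConn_cls i a) ?_
  rw [Set.Subset.antisymm h (cls_subset (Nat.le_succ _) a)]
  exact cutConn_cls (i + 1) a

/-- A vertex is separated from another at some step unless it is in the same class. -/
theorem exists_separation {n : ℕ} {x y : V} (h : ¬ decRel G n x y) :
    ∃ m < n, decRel G m x y ∧ ¬ decRel G (m + 1) x y := by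
  induction n with
  | zero => exact absurd trivial h
  | succ n ih =>
    by_cases hn : decRel G n x y
    · exact ⟨n, Nat.lt_succ_self n, hn, h⟩
    · obtain ⟨m, hm, hm'⟩ := ih hn
      exact ⟨m, by omega, hm'⟩

end Dec

/-! ### Induced embeddings between vertex sets -/

section Emb

variable {V W X : Type*}

/-- `f` is an isomorphism of the graphs induced on `S` and `f '' S`. -/
def IndMap (G : SimpleGraph V) (H : SimpleGraph W) (f : V → W) (S : Set V) : Prop :=
  ∀ x ∈ S, ∀ y ∈ S, (x = y ↔ f x = f y) ∧ (G.Adj x y ↔ H.Adj (f x) (f y))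

/-- The graph induced by `G` on `S` embeds into the graph induced by `H` on `T`. -/
def Emb (G : SimpleGraph V) (H : SimpleGraph W) (S : Set V) (T : Set W) : Prop :=
  ∃ f : V → W, IndMap G H f S ∧ f '' S ⊆ T

variable {G : SimpleGraph V} {H : SimpleGraph W} {F : SimpleGraph X}

theorem IndMap.mono {f : V → W} {S S' : Set V} (h : IndMap G H f S) (hS : S' ⊆ S) :
    IndMap G H f S' := fun x hx y hy => h x (hS hx) y (hS hy)

theorem IndMap.injOn {f : V → W} {S : Set V} (h : IndMap G H f S) : Set.InjOn f S :=
  fun x hx y hy e => (h x hx y hy).1.2 e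

theorem IndMap.level_adj {f : V → W} {S : Set V} (h : IndMap G H f S) {x y : V} (hx : x ∈ S)
    (hy : y ∈ S) (i : ℕ) : (level G i).Adj x y ↔ (level H i).Adj (f x) (f y) := by
  by_cases hxy : x = y
  · subst hxy; simp
  · rw [LogicalDepth.level_adj G hxy, LogicalDepth.level_adj H ((h x hx y hy).1.not.1 hxy),
      (h x hx y hy).2]

theorem IndMap.cutConn {f : V → W} {S : Set V} (h : IndMap G H f S) {i : ℕ}
    (hS : CutConn (level G i) S) : CutConn (level H i) (f '' S) := by
  rintro T ⟨_, ⟨x, hx, rfl⟩, hxT⟩ ⟨_, ⟨y, hy, rfl⟩, hyT⟩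
  obtain ⟨u, hu, hu', v, hv, hv', huv⟩ := hS (f ⁻¹' T) ⟨x, hx, hxT⟩ ⟨y, hy, hyT⟩
  exact ⟨f u, ⟨u, hu, rfl⟩, hu', f v, ⟨v, hv, rfl⟩, hv', (h.level_adj hu hv i).1 huv⟩

theorem IndMap.cutCC {f : V → W} {S : Set V} (h : IndMap G H f S) (hS : CutCC G S) :
    CutCC H (f '' S) := ⟨h.cutConn (i := 0) hS.1, h.cutConn (i := 1) hS.2⟩

theorem Emb.refl (S : Set V) : Emb G G S S := ⟨id, fun _ _ _ _ => ⟨Iff.rfl, Iff.rfl⟩, by simp⟩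

theorem Emb.trans {S : Set V} {T : Set W} {U : Set X} (h : Emb G H S T) (h' : Emb H F T U) :
    Emb G F S U := by
  obtain ⟨f, hf, hfS⟩ := h
  obtain ⟨g, hg, hgT⟩ := h'
  refine ⟨g ∘ f, fun x hx y hy => ?_, ?_⟩
  · have hx' := hfS ⟨x, hx, rfl⟩
    have hy' := hfS ⟨y, hy, rfl⟩
    exact ⟨(hf x hx y hy).1.trans (hg _ hx' _ hy').1, (hf x hx y hy).2.trans (hg _ hx' _ hy').2⟩
  · rw [Set.image_comp]
    exact (Set.image_mono hfS).trans hgT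

theorem Emb.mono {S S' : Set V} {T T' : Set W} (h : Emb G H S T) (hS : S' ⊆ S) (hT : T ⊆ T') :
    Emb G H S' T' := by
  obtain ⟨f, hf, hfS⟩ := h
  exact ⟨f, hf.mono hS, (Set.image_mono hS).trans (hfS.trans hT)⟩

theorem Emb.ncard_le [Finite W] {S : Set V} {T : Set W} (h : Emb G H S T) : S.ncard ≤ T.ncard := by
  obtain ⟨f, hf, hfS⟩ := h
  rw [← hf.injOn.ncard_image]
  exact Set.ncard_le_ncard hfS (Set.toFinite _)

/-- Embeddings both ways between finite sets force equal cardinalities. This is why mutual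
embeddability can stand for isomorphism throughout. -/
theorem IndMap.image_eq [Finite V] [Finite W] {f : V → W} {S : Set V} {T : Set W}
    (hf : IndMap G H f S) (hfS : f '' S ⊆ T) (h : Emb H G T S) : f '' S = T := by
  refine Set.eq_of_subset_of_ncard_le hfS ?_ (Set.toFinite _)
  rw [hf.injOn.ncard_image]
  exact h.ncard_le

theorem IndMap.emb_image {f : V → W} {S : Set V} (hf : IndMap G H f S) : Emb G H S (f '' S) :=
  ⟨f, hf, subset_rfl⟩

theorem IndMap.emb_symm [Nonempty V] {f : V → W} {S : Set V} (hf : IndMap G H f S) :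
    Emb H G (f '' S) S := by
  refine ⟨Function.invFunOn f S, ?_, ?_⟩
  · rintro _ ⟨x, hx, rfl⟩ _ ⟨y, hy, rfl⟩
    rw [hf.injOn.leftInvOn_invFunOn hx, hf.injOn.leftInvOn_invFunOn hy]
    exact ⟨(hf x hx y hy).1.symm, (hf x hx y hy).2.symm⟩
  · rintro _ ⟨_, ⟨x, hx, rfl⟩, rfl⟩
    rwa [hf.injOn.leftInvOn_invFunOn hx]

/-- A class that is mapped into a class is mapped into a lower class by every lower class. -/
theorem IndMap.image_cls_subset {f : V → W} {l : ℕ} {a : V} {b : W}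
    (hf : IndMap G H f (cls G l a)) (h : f '' cls G l a ⊆ cls H l b) {j : ℕ} (hj : l ≤ j) {y : V}
    (hy : y ∈ cls G l a) : f '' cls G j y ⊆ cls H j (f y) := by
  induction j, hj using Nat.le_induction with
  | base =>
    rw [← cls_eq hy, ← cls_eq (h ⟨y, hy, rfl⟩)]
    exact h
  | succ j hj ih =>
    have hsub : cls G (j + 1) y ⊆ cls G l a := by
      rw [cls_eq hy]; exact cls_subset (by omega) y
    refine subset_cls_succ ((hf.mono hsub).cutConn (cutConn_cls j y)) ⟨y, self_mem_cls _ _, rfl⟩ ?_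
    exact (Set.image_mono (cls_subset (Nat.le_succ j) y)).trans ih

/-- An isomorphism between classes maps all lower classes onto lower classes. -/
theorem IndMap.image_cls {f : V → W} {l : ℕ} {a : V} {b : W} (hf : IndMap G H f (cls G l a))
    (h : f '' cls G l a = cls H l b) {j : ℕ} (hj : l ≤ j) {y : V} (hy : y ∈ cls G l a) :
    f '' cls G j y = cls H j (f y) := by
  refine Set.Subset.antisymm (hf.image_cls_subset h.subset hj hy) ?_
  induction j, hj using Nat.le_induction with
  | base =>
    rw [← cls_eq hy, ← cls_eq (h.subset ⟨y, hy, rfl⟩)]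
    exact h.symm.subset
  | succ j hj ih =>
    have hsub : cls G j y ⊆ cls G l a := by
      rw [cls_eq hy]; exact cls_subset (by omega) y
    by_contra hn
    obtain ⟨z, hz, hz'⟩ := Set.not_subset.1 hn
    obtain ⟨_, -, ⟨u, hu, rfl⟩, v, hv, hv', huv⟩ := cutConn_cls j (f y) (f '' cls G (j + 1) y)
      ⟨f y, self_mem_cls _ _, y, self_mem_cls _ _, rfl⟩ ⟨z, hz, hz'⟩
    obtain ⟨v, hvy, rfl⟩ := ih (decRel_of_succ hv)
    have huy := decRel_of_succ hu
    refine hv' ⟨v, decRel_trans hu (decRel_succ_of_adj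
      (decRel_trans (decRel_symm huy) hvy) ?_), rfl⟩
    exact (hf.level_adj (hsub huy) (hsub hvy) j).2 huv

end Emb

/-! ### Spoiler's descent through the decompositions -/

section Descend

variable {V W : Type*} {G : SimpleGraph V} {H : SimpleGraph W}

theorem Consistent.adj_iff {P : Set (V × W)} (h : Consistent G H P) {a u : V} {b w : W}
    (hab : (a, b) ∈ P) (huw : (u, w) ∈ P) : G.Adj a u ↔ H.Adj b w := (h _ hab _ huw).2

theorem Consistent.eq_iff {P : Set (V × W)} (h : Consistent G H P) {a u : V} {b w : W}
    (hab : (a, b) ∈ P) (huw : (u, w) ∈ P) : a = u ↔ b = w := (h _ hab _ huw).1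

theorem Consistent.odd_iff {P : Set (V × W)} (h : Consistent G H P) {a u : V} {b w : W}
    (hab : (a, b) ∈ P) (huw : (u, w) ∈ P) {m m' : ℕ} (hm : decRel G m a u)
    (hm' : ¬ decRel G (m + 1) a u) (hn : decRel H m' b w) (hn' : ¬ decRel H (m' + 1) b w) :
    Odd m ↔ Odd m' :=
  (adj_iff_odd hm hm').symm.trans ((h.adj_iff hab huw).trans (adj_iff_odd hn hn'))

/-- In every consistent extension of `P`, a vertex in the class of `a` at step `t` is answered by
a vertex that is not separated from `b` at an earlier step of the same parity. -/
def Confined (G : SimpleGraph V) (H : SimpleGraph W) (P : Set (V × W)) (t : ℕ) (a : V) (b : W) :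
    Prop :=
  ∀ u w, Consistent G H (insert (u, w) P) → decRel G t a u → ∀ m < t, (Odd m ↔ Odd t) →
    decRel H m b w → decRel H (m + 1) b w

theorem Confined.mono {P Q : Set (V × W)} {t : ℕ} {a : V} {b : W} (h : Confined G H P t a b)
    (hPQ : P ⊆ Q) : Confined G H Q t a b :=
  fun u w hc => h u w (hc.mono (Set.insert_subset_insert hPQ))

/-- Only step 0 precedes step 1, and it has the wrong parity. -/
theorem confined_one (P : Set (V × W)) (a : V) (b : W) : Confined G H P 1 a b := by
  intro u w _ _ m hm hodd
  obtain rfl : m = 0 := by omega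
  simp at hodd

/-- The pebbles on `a` and `b` stand guard. A vertex in the new class of `y` is separated from `a`
at step `l`; an answer leaving `w` at an earlier step leaves `b` at that same step, so its parity
must be that of `l`, not of `l + 1`. -/
theorem confined_of_separated {P : Set (V × W)} {l : ℕ} {a y : V} {b w : W} (hab : (a, b) ∈ P)
    (h : decRel G l a y) (h' : ¬ decRel G (l + 1) a y) (hw : decRel H l b w) :
    Confined G H P (l + 1) y w := by
  intro u w' hc hu m hm hodd hmw
  by_contra hn
  have hml : m < l := by
    rcases Nat.lt_succ_iff_lt_or_eq.1 hm with h | rfl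
    · exact h
    · rw [Nat.odd_add_one] at hodd; tauto
  have h1 : decRel H m b w' := decRel_trans (decRel_of_le hml.le hw) hmw
  have h2 : ¬ decRel H (m + 1) b w' := fun h2 =>
    hn (decRel_trans (decRel_symm (decRel_of_le hml hw)) h2)
  have h3 : decRel G l a u := decRel_trans h (decRel_of_succ hu)
  have h4 : ¬ decRel G (l + 1) a u := fun h4 => h' (decRel_trans h4 (decRel_symm hu))
  have := hc.odd_iff (Set.mem_insert_of_mem _ hab) (Set.mem_insert _ _) h3 h4 h1 h2
  rw [Nat.odd_add_one] at hodd
  tauto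

/-- Spoiler wins if a vertex that is separated from `a` at step `m` is answered by a vertex that is
separated from `b` at an earlier step. -/
theorem not_survives_of_early_separation {m : ℕ} {r t m' : ℕ} {P : Set (V × W)} {a u : V} {b w : W}
    (hS : Survives G H r P) (hconf : Confined G H P t a b) (hab : (a, b) ∈ P) (huw : (u, w) ∈ P)
    (htm : t ≤ m) (hm : decRel G m a u) (hm' : ¬ decRel G (m + 1) a u)
    (hn : decRel H m' b w) (hn' : ¬ decRel H (m' + 1) b w) (hlt : m' < m)
    (hsep : ∀ j, t ≤ j → j < m → ∃ z, decRel G j a z ∧ ¬ decRel G (j + 1) a z)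
    (hr : m ≤ r + t) : False := by
  induction m using Nat.strong_induction_on generalizing r m' P u w with
  | _ m ih =>
  have hpar := hS.consistent.odd_iff hab huw hm hm' hn hn'
  by_cases hbad : m' < t ∧ (Odd m' ↔ Odd t)
  · refine hn' (hconf u w ?_ (decRel_of_le htm hm) m' hbad.1 hbad.2 hn)
    rw [Set.insert_eq_of_mem huw]; exact hS.consistent
  -- Take `j = t` if `m' < t`: confinement makes their parities differ, so also `t ≠ m`. Otherwise
  -- take `j = m' + 1`, which is below `m` because `m` and `m'` have the same parity.
  obtain ⟨j, htj, hjm, hmj, hpj⟩ : ∃ j, t ≤ j ∧ j < m ∧ m' < j ∧ (Odd j ↔ ¬ Odd m') := by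
    by_cases h : m' < t
    · refine ⟨t, le_rfl, ?_, h, by tauto⟩
      refine lt_of_le_of_ne htm ?_
      rintro rfl; exact hbad ⟨h, hpar.symm⟩
    · refine ⟨m' + 1, by omega, ?_, by omega, Nat.odd_add_one⟩
      refine lt_of_le_of_ne hlt ?_
      rintro rfl
      rw [Nat.odd_add_one] at hpar; tauto
  obtain ⟨z, hz, hz'⟩ := hsep j htj hjm
  obtain ⟨z', hS'⟩ := hS.play (s := r - 1) (by omega) z
  have hzu : decRel G j z u := decRel_trans (decRel_symm hz) (decRel_of_le hjm.le hm)
  have hzu' : ¬ decRel G (j + 1) z u := fun h =>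
    hz' (decRel_trans (decRel_of_le hjm hm) (decRel_symm h))
  have hab' := Set.mem_insert_of_mem (z, z') hab
  have huw' := Set.mem_insert_of_mem (z, z') huw
  have hzz := Set.mem_insert (z, z') P
  -- Staying with `b` would separate `z'` from `w` at step `m'`, while `z` and `u` are separated at
  -- step `j` of the other parity.
  have hbz : ¬ decRel H (m' + 1) b z' := by
    intro hbz
    have h1 : decRel H m' z' w := decRel_trans (decRel_symm (decRel_of_succ hbz)) hn
    have h2 : ¬ decRel H (m' + 1) z' w := fun h => hn' (decRel_trans hbz h)
    have := hS'.consistent.odd_iff hzz huw' hzu hzu' h1 h2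
    tauto
  obtain ⟨n, hnm, h1, h2⟩ := exists_separation hbz
  exact ih j hjm hS' (hconf.mono (Set.subset_insert _ _)) hab' hzz htj hz hz' h1 h2 (by omega)
    (fun i hi hij => hsep i hi (by omega)) (by omega)

/-- Below step `t`, the part of `G` around `a` decomposes down to step `K` into pairwise
non-isomorphic pieces, which embed into pieces of `H` only if these are isomorphic; the final
pieces are complement-connected and have at most `c` vertices. -/
structure Regular (G : SimpleGraph V) (H : SimpleGraph W) (K c t : ℕ) (a : V) : Prop where
  antichain : ∀ y, decRel G t a y → ∀ j, t < j → j ≤ K → ∀ b,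
    Emb G H (cls G j y) (cls H j b) → Emb H G (cls H j b) (cls G j y)
  siblings : ∀ y, decRel G t a y → ∀ j, t ≤ j → j < K → ∀ y', decRel G j y y' →
    Emb G G (cls G (j + 1) y) (cls G (j + 1) y') → decRel G (j + 1) y y'
  separated : ∀ y, decRel G t a y → ∀ j, t ≤ j → j < K → ∃ z, decRel G j y z ∧
    ¬ decRel G (j + 1) y z
  cc : ∀ y, decRel G t a y → CutCC G (cls G K y)
  card_le : ∀ y, decRel G t a y → (cls G K y).ncard ≤ c

theorem Regular.mono {K c t t' : ℕ} {a a' : V} (h : Regular G H K c t a) (ht : t ≤ t')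
    (ha : decRel G t a a') : Regular G H K c t' a' where
  antichain y hy j hj := h.antichain y (decRel_trans ha (decRel_of_le ht hy)) j (by omega)
  siblings y hy j hj := h.siblings y (decRel_trans ha (decRel_of_le ht hy)) j (by omega)
  separated y hy j hj := h.separated y (decRel_trans ha (decRel_of_le ht hy)) j (by omega)
  cc y hy := h.cc y (decRel_trans ha (decRel_of_le ht hy))
  card_le y hy := h.card_le y (decRel_trans ha (decRel_of_le ht hy))

/-- A piece that does not embed into another one has a component that does not embed into any
component of the other one. -/
theorem Regular.exists_component [Nonempty W] {K c t j : ℕ} {a y : V} {b : W}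
    (h : Regular G H K c t a) (hy : decRel G t a y) (htj : t ≤ j) (hj : j < K)
    (hE : ¬ Emb G H (cls G j y) (cls H j b)) :
    ∃ y₂, decRel G j y y₂ ∧ ∀ b₂, decRel H j b b₂ →
      ¬ Emb G H (cls G (j + 1) y₂) (cls H (j + 1) b₂) := by
  classical
  by_contra! hc
  have hc' : ∀ y₂, ∃ b₂, ∃ f : V → W, decRel G j y y₂ → decRel H j b b₂ ∧
      IndMap G H f (cls G (j + 1) y₂) ∧ f '' cls G (j + 1) y₂ ⊆ cls H (j + 1) b₂ := by
    intro y₂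
    by_cases hy₂ : decRel G j y y₂
    · obtain ⟨b₂, hb₂, f, hf⟩ := hc y₂ hy₂
      exact ⟨b₂, f, fun _ => ⟨hb₂, hf⟩⟩
    · exact ⟨b, fun _ => b, fun h => absurd h hy₂⟩
  choose β f hf using hc'
  -- Representatives fix a single embedding on each whole component.
  let s : Setoid V := ⟨decRel G (j + 1), decRel_refl _, decRel_symm, decRel_trans⟩
  let ρ : V → V := fun x => (Quotient.mk s x).out
  have hρ : ∀ x, decRel G (j + 1) (ρ x) x := fun x => Quotient.exact (Quotient.out_eq (Quotient.mk s x))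
  have hρeq : ∀ {x x'}, decRel G (j + 1) x x' → ρ x = ρ x' := fun {x x'} hx =>
    congrArg Quotient.out (Quotient.sound (s := s) hx)
  have hρy : ∀ {x}, decRel G j y x → decRel G j y (ρ x) := fun {x} hx =>
    decRel_trans hx (decRel_symm (decRel_of_succ (hρ x)))
  have hmem : ∀ {x}, decRel G j y x → decRel H (j + 1) (β (ρ x)) (f (ρ x) x) := fun {x} hx =>
    (hf _ (hρy hx)).2.2 ⟨x, hρ x, rfl⟩
  refine hE ⟨fun x => f (ρ x) x, ?_, ?_⟩
  · intro x hx x' hx'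
    by_cases hxx : decRel G (j + 1) x x'
    · have := (hf _ (hρy hx)).2.1 x (hρ x) x' (decRel_trans (hρ x) hxx)
      simpa [hρeq hxx] using this
    · have hb : decRel H j (f (ρ x) x) (f (ρ x') x') :=
        decRel_trans (decRel_symm (decRel_of_succ (hmem hx)))
          (decRel_trans (decRel_symm (hf _ (hρy hx)).1)
            (decRel_trans (hf _ (hρy hx')).1 (decRel_of_succ (hmem hx'))))
      -- If two components went into one piece of `H`, that piece would embed back into the second,
      -- so the first would embed into its sibling.
      have hb' : ¬ decRel H (j + 1) (f (ρ x) x) (f (ρ x') x') := by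
        intro hb'
        have e : cls H (j + 1) (β (ρ x)) = cls H (j + 1) (β (ρ x')) :=
          cls_eq (decRel_trans (hmem hx) (decRel_trans hb' (decRel_symm (hmem hx'))))
        have e1 : Emb G H (cls G (j + 1) (ρ x)) (cls H (j + 1) (β (ρ x))) := ⟨_, (hf _ (hρy hx)).2⟩
        have e2 : Emb G H (cls G (j + 1) (ρ x')) (cls H (j + 1) (β (ρ x'))) :=
          ⟨_, (hf _ (hρy hx')).2⟩
        have e3 := h.antichain _ (decRel_trans hy (decRel_of_le htj (hρy hx'))) (j + 1) (by omega)
          (by omega) _ e2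
        rw [← e] at e3
        have := h.siblings _ (decRel_trans hy (decRel_of_le htj (hρy hx))) j htj hj (ρ x')
          (decRel_trans (decRel_symm (hρy hx)) (hρy hx')) (e1.trans e3)
        exact hxx (decRel_trans (decRel_symm (hρ x)) (decRel_trans this (hρ x')))
      have hg : decRel G j x x' := decRel_trans (decRel_symm hx) hx'
      refine ⟨iff_of_false (ne_of_not_decRel hxx) (ne_of_not_decRel hb'), ?_⟩
      rw [adj_iff_odd hg hxx, adj_iff_odd hb hb']
  · rintro _ ⟨x, hx, rfl⟩
    exact decRel_trans (hf _ (hρy hx)).1 (decRel_of_succ (hmem hx))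

/-- If Duplicator survives after Spoiler has selected the complement-connected set `S`, then the
answers lie in one class. -/
theorem Survives.play_cc [Finite V] [Nonempty W] {r s : ℕ} {P : Set (V × W)} {S : Set V}
    (h : Survives G H r P) (hS : CutCC G S) (hs : s + S.ncard ≤ r) :
    ∃ f : V → W, Survives G H s (P ∪ (fun x => (x, f x)) '' S) ∧ IndMap G H f S ∧
      ∀ a ∈ S, ∀ i, f '' S ⊆ cls H i (f a) := by
  obtain ⟨f, hf⟩ := h.play_set S hs
  have hmap : IndMap G H f S := fun x hx y hy =>
    hf.consistent _ (Or.inr ⟨x, hx, rfl⟩) _ (Or.inr ⟨y, hy, rfl⟩)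
  exact ⟨f, hf, hmap, fun a ha i => (hmap.cutCC hS).subset_cls ⟨a, ha, rfl⟩ i⟩

/-- Spoiler wins by descending from a piece that does not embed into the corresponding piece of
the other graph to a final piece with this property. -/
theorem not_survives_of_not_emb [Finite V] [Nonempty W] {K c t s r : ℕ} {P : Set (V × W)}
    {a : V} {b : W} (hreg : Regular G H K c t a) (hS : Survives G H r P) (hab : (a, b) ∈ P)
    (hconf : Confined G H P t a b) (hts : t ≤ s) (hsK : s ≤ K) (hsc : s ≤ t + c)
    (hE : ¬ Emb G H (cls G s a) (cls H s b)) (hr : K + c ≤ r + s) : False := by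
  induction hk : K - s using Nat.strong_induction_on generalizing s t r P a b with
  | _ k ih =>
  -- Follow the classes of `a` and `b` down until the next ones embed or step `K` is reached.
  obtain ⟨l, hsl, hlK, hEl, hlmax⟩ : ∃ l, s ≤ l ∧ l ≤ K ∧ ¬ Emb G H (cls G l a) (cls H l b) ∧
      (l < K → Emb G H (cls G (l + 1) a) (cls H (l + 1) b)) := by
    by_contra! hc
    have : ∀ l, s ≤ l → l ≤ K → ¬ Emb G H (cls G l a) (cls H l b) := by
      intro l hl
      induction l, hl using Nat.le_induction with
      | base => exact fun _ => hE
      | succ l hl ih' => exact fun hlK => (hc l hl (by omega) (ih' (by omega))).2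
    exact absurd (hc K hsK le_rfl (this K hsK le_rfl)).1 (lt_irrefl _)
  have haa := decRel_refl (G := G) t a
  rcases hlK.eq_or_lt with rfl | hlK
  · obtain ⟨f, hf, hmap, hfS⟩ := hS.play_cc (s := 0) (hreg.cc a haa)
      (by have := hreg.card_le a haa; omega)
    have hfa : b = f a := (hf.consistent.eq_iff (Or.inl hab)
      (Or.inr ⟨a, self_mem_cls _ _, rfl⟩)).1 rfl
    exact hEl ⟨f, hmap, hfa ▸ hfS a (self_mem_cls _ _) l⟩
  · obtain ⟨y, hy, hyE⟩ := hreg.exists_component haa (hts.trans hsl) hlK hEl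
    have hy' : ¬ decRel G (l + 1) a y := by
      intro hy'
      refine hyE b (decRel_refl _ _) ?_
      rw [← cls_eq hy']; exact hlmax hlK
    obtain ⟨w, hS'⟩ := hS.play (s := r - 1) (by omega) y
    have hab' := Set.mem_insert_of_mem (y, w) hab
    have hyw := Set.mem_insert (y, w) P
    by_cases hw : decRel H l b w
    · exact ih (K - (l + 1)) (by omega) (hreg.mono (by omega) (decRel_of_le (by omega) hy)) hS' hyw
        (confined_of_separated hab' hy hy' hw) le_rfl (by omega) (by omega) (hyE w hw) (by omega) rfl
    -- The bound `s ≤ t + c` guarantees enough rounds here: the reserve of `c` rounds covers the gap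
    -- between `s` and `t`.
    · obtain ⟨n, hnl, h1, h2⟩ := exists_separation hw
      exact not_survives_of_early_separation hS' (hconf.mono (Set.subset_insert _ _)) hab' hyw
        (by omega) hy hy' h1 h2 hnl
        (fun j hj hjl => hreg.separated a haa j hj (by omega)) (by omega)

end Descend

/-! ### Small complement-connected subgraphs -/

section Removal

variable {V : Type*} {F G : SimpleGraph V}

theorem cutConn_iff_closed {S : Set V} : CutConn F S ↔ ∀ T : Set V,
    (∀ x ∈ S, ∀ y ∈ S, F.Adj x y → x ∈ T → y ∈ T) → ∀ x ∈ S, ∀ y ∈ S, x ∈ T → y ∈ T := by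
  constructor
  · intro h T hT x hx y hy hxT
    by_contra hyT
    obtain ⟨u, hu, huT, v, hv, hvT, huv⟩ := h T ⟨x, hx, hxT⟩ ⟨y, hy, hyT⟩
    exact hvT (hT u hu v hv huv huT)
  · rintro h T ⟨x, hx, hxT⟩ ⟨y, hy, hyT⟩
    by_contra! hc
    refine hyT (h T (fun u hu v hv huv huT => ?_) x hx y hy hxT)
    by_contra hvT
    exact hc u hu huT v hv hvT huv

theorem cutConn_singleton (x : V) : CutConn F {x} := by
  rintro T ⟨y, rfl, hy⟩ ⟨z, rfl, hz⟩
  exact absurd hy hz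

theorem CutConn.insert {S : Set V} (h : CutConn F S) {t w : V} (ht : t ∈ S) (hw : F.Adj t w) :
    CutConn F (insert w S) := by
  rw [cutConn_iff_closed] at h ⊢
  intro T hT
  have hS := h T fun x hx y hy => hT x (Or.inr hx) y (Or.inr hy)
  have h1 : t ∈ T → w ∈ T := hT t (Or.inr ht) w (Or.inl rfl) hw
  have h2 : w ∈ T → t ∈ T := hT w (Or.inl rfl) t (Or.inr ht) hw.symm
  rintro x (rfl | hx) y (rfl | hy) hxT
  · exact hxT
  · exact hS t ht y hy (h2 hxT)
  · exact h1 (hS x hx t ht hxT)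
  · exact hS x hx y hy hxT

/-- A connected set that properly contains a connected set `T` stays connected after removal of
some vertex outside `T`. -/
theorem CutConn.exists_diff_singleton [Finite V] {S T : Set V} (hS : CutConn F S)
    (hT : CutConn F T) (hTS : T ⊂ S) (hne : T.Nonempty) : ∃ u ∈ S, u ∉ T ∧ CutConn F (S \ {u}) := by
  induction hn : (S \ T).ncard using Nat.strong_induction_on generalizing T with
  | _ n ih =>
  obtain ⟨t₀, ht₀⟩ := hne
  obtain ⟨s, hs, hsT⟩ := Set.exists_of_ssubset hTS
  obtain ⟨t, -, ht, w, hw, hwT, htw⟩ := hS T ⟨t₀, hTS.1 ht₀, ht₀⟩ ⟨s, hs, hsT⟩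
  have hsub : Insert.insert w T ⊆ S := Set.insert_subset hw hTS.1
  by_cases he : Insert.insert w T = S
  · refine ⟨w, hw, hwT, ?_⟩
    rw [← he, Set.insert_sdiff_self_of_notMem hwT]
    exact hT
  · obtain ⟨u, hu, huT, h⟩ := ih (S \ Insert.insert w T).ncard (by
      rw [← hn]
      refine Set.ncard_lt_ncard ⟨Set.sdiff_subset_sdiff_right (Set.subset_insert _ _), fun h => ?_⟩
        (Set.toFinite _)
      exact (h ⟨hw, hwT⟩).2 (Set.mem_insert _ _)) (hT.insert ht htw)
      (hsub.ssubset_of_ne he) ⟨w, Set.mem_insert _ _⟩ rfl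
    exact ⟨u, hu, fun h' => huT (Or.inr h'), h⟩

/-- The side `Q` of a cutvertex `v` is connected together with `v`. -/
theorem CutConn.side {S Q R : Set V} {v : V} (hS : CutConn F S) (hQR : S = Insert.insert v (Q ∪ R))
    (hno : ∀ q ∈ Q, ∀ r ∈ R, ¬ F.Adj q r) (hRQ : ∀ r ∈ R, r ∉ Q ∧ r ≠ v) :
    CutConn F (Insert.insert v Q) := by
  rw [cutConn_iff_closed] at hS ⊢
  subst hQR
  intro T hT x hx y hy hxT
  have hmem : ∀ z ∈ Insert.insert v Q, z ∈ Insert.insert v (Q ∪ R) := by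
    rintro z (rfl | hz)
    exacts [Or.inl rfl, Or.inr (Or.inl hz)]
  have := hS {z | (z ∈ Insert.insert v Q ∧ z ∈ T) ∨ (z ∈ R ∧ v ∈ T)} ?_ x (hmem x hx) y (hmem y hy)
    (Or.inl ⟨hx, hxT⟩)
  · rcases this with h | h
    · exact h.2
    · rcases hy with rfl | hy
      exacts [h.2, absurd hy (hRQ y h.1).1]
  · rintro a ha b hb hab (⟨ha', haT⟩ | ⟨haR, hvT⟩)
    · rcases hb with rfl | hb | hb
      · exact Or.inl ⟨Or.inl rfl, hT a ha' b (Or.inl rfl) hab haT⟩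
      · exact Or.inl ⟨Or.inr hb, hT a ha' b (Or.inr hb) hab haT⟩
      · rcases ha' with rfl | ha'
        · exact Or.inr ⟨hb, haT⟩
        · exact absurd hab (hno a ha' b hb)
    · rcases hb with rfl | hb | hb
      · exact Or.inl ⟨Or.inl rfl, hvT⟩
      · exact absurd hab.symm (hno b hb a haR)
      · exact Or.inr ⟨hb, hvT⟩

/-- In the complement `Q` and `R` are completely joined, and `x₀` ties `v` to them. -/
theorem cutConn_compl_of_sides {Q R : Set V} {v x₀ : V} (hQ : Q.Nonempty) (hR : R.Nonempty)
    (hno : ∀ q ∈ Q, ∀ r ∈ R, ¬ F.Adj q r) (hRQ : ∀ r ∈ R, r ∉ Q)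
    (hx₀ : x₀ ∈ Q ∪ R) (hv : x₀ ≠ v) (hadj : ¬ F.Adj x₀ v) :
    CutConn Fᶜ (Insert.insert v (Q ∪ R)) := by
  rw [cutConn_iff_closed]
  intro T hT
  obtain ⟨q₀, hq₀⟩ := hQ
  obtain ⟨r₀, hr₀⟩ := hR
  have hqr : ∀ q ∈ Q, ∀ r ∈ R, (q ∈ T ↔ r ∈ T) := by
    intro q hq r hr
    have : Fᶜ.Adj q r := ⟨fun e => hRQ r hr (e ▸ hq), hno q hq r hr⟩
    exact ⟨hT q (Or.inr (Or.inl hq)) r (Or.inr (Or.inr hr)) this,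
      hT r (Or.inr (Or.inr hr)) q (Or.inr (Or.inl hq)) this.symm⟩
  have hall : ∀ z ∈ Q ∪ R, (z ∈ T ↔ q₀ ∈ T) := by
    rintro z (hz | hz)
    · rw [hqr z hz r₀ hr₀, hqr q₀ hq₀ r₀ hr₀]
    · exact (hqr q₀ hq₀ z hz).symm
  have hxv : Fᶜ.Adj x₀ v := ⟨hv, hadj⟩
  have hv' : v ∈ T ↔ q₀ ∈ T := by
    rw [← hall x₀ hx₀]
    exact ⟨hT v (Or.inl rfl) x₀ (Or.inr hx₀) hxv.symm, hT x₀ (Or.inr hx₀) v (Or.inl rfl) hxv⟩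
  have hall' : ∀ z ∈ Insert.insert v (Q ∪ R), (z ∈ T ↔ q₀ ∈ T) := by
    rintro z (rfl | hz)
    exacts [hv', hall z hz]
  intro x hx y hy
  rw [hall' x hx, hall' y hy]
  exact id

theorem exists_removable_of_cut [Finite V] {S Q R : Set V} {v q₀ : V} (hS : CutConn F S)
    (hQR : S = Insert.insert v (Q ∪ R)) (hno : ∀ q ∈ Q, ∀ r ∈ R, ¬ F.Adj q r)
    (hdisj : ∀ r ∈ R, r ∉ Q) (hvQ : v ∉ Q) (hvR : v ∉ R) (hR : R.Nonempty)
    (hq₀ : q₀ ∈ Q) (hadj : ¬ F.Adj q₀ v) (hcard : 5 ≤ S.ncard) :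
    ∃ u ∈ S, CutCC F (S \ {u}) := by
  have hQv : CutConn F (Insert.insert v Q) :=
    hS.side hQR hno fun r hr => ⟨hdisj r hr, fun e => hvR (e ▸ hr)⟩
  have hRv : CutConn F (Insert.insert v R) :=
    hS.side (Q := R) (R := Q) (by rw [hQR, Set.union_comm]) (fun r hr q hq h => hno q hq r hr h.symm)
      fun q hq => ⟨fun h => hdisj q h hq, fun e => hvQ (e ▸ hq)⟩
  have hq₀v : q₀ ≠ v := fun e => hvQ (e ▸ hq₀)
  -- The complement stays connected as long as both sides and a nonneighbour of `v` in `Q` survive;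
  -- only connectedness in `F` remains to be arranged.
  have key : ∀ u ∈ S, u ≠ v → (Q \ {u}).Nonempty → (R \ {u}).Nonempty →
      (∃ x ∈ Q, x ≠ u ∧ ¬ F.Adj x v) → CutConn F (S \ {u}) → ∃ u ∈ S, CutCC F (S \ {u}) := by
    rintro u hu huv hQ' hR' ⟨x, hx, hxu, hxv⟩ hconn
    refine ⟨u, hu, hconn, ?_⟩
    have : S \ {u} = Insert.insert v ((Q \ {u}) ∪ (R \ {u})) := by
      rw [hQR, Set.insert_sdiff_of_notMem _ (by simpa using huv.symm), Set.union_sdiff_distrib]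
    rw [this]
    exact cutConn_compl_of_sides hQ' hR' (fun q hq r hr => hno q hq.1 r hr.1)
      (fun r hr h => hdisj r hr.1 h.1) (Or.inl ⟨hx, hxu⟩) (fun e => hvQ (e ▸ hx)) hxv
  obtain ⟨r, hr⟩ := hR
  have hrq₀ : r ≠ q₀ := fun e => hdisj r hr (e ▸ hq₀)
  have hrv : r ≠ v := fun e => hvR (e ▸ hr)
  -- If `R` has two vertices, one of them can be deleted while `Q` and `v` are kept.
  by_cases hR2 : ∃ r' ∈ R, r' ≠ r
  · obtain ⟨r', hr', hne⟩ := hR2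
    obtain ⟨u, hu, huT, hc⟩ := hS.exists_diff_singleton hQv (T := Insert.insert v Q)
      ⟨by rw [hQR]; exact Set.insert_subset_insert Set.subset_union_left, fun h => by
        rcases h (by rw [hQR]; exact Or.inr (Or.inr hr)) with h | h
        exacts [hrv h, hdisj r hr h]⟩ ⟨v, Or.inl rfl⟩
    have huv : u ≠ v := fun e => huT (Or.inl e)
    have huQ : u ∉ Q := fun e => huT (Or.inr e)
    have hne₀ : q₀ ≠ u := fun e => huQ (e ▸ hq₀)
    refine key u hu huv ⟨q₀, hq₀, hne₀⟩ ?_ ⟨q₀, hq₀, hne₀, hadj⟩ hc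
    by_cases hur : u = r
    · exact ⟨r', hr', fun e => hne (by rw [← hur]; exact e)⟩
    · exact ⟨r, hr, fun e => hur e.symm⟩
  · push Not at hR2
    have hvr : F.Adj v r := by
      obtain ⟨x, hx, hxT, y, hy, hyT, hxy⟩ := hRv {v} ⟨v, Or.inl rfl, rfl⟩ ⟨r, Or.inr hr, hrv⟩
      obtain rfl : x = v := hxT
      rcases hy with rfl | hy
      · exact absurd rfl hyT
      · rwa [hR2 y hy] at hxy
    -- With `R = {r}` and two nonneighbours of `v` in `Q`, a vertex of `Q` can be deleted; one of
    -- the two survives.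
    by_cases hq₁ : ∃ q₁ ∈ Q, q₁ ≠ q₀ ∧ ¬ F.Adj q₁ v
    · obtain ⟨q₁, hq₁, hne, hadj₁⟩ := hq₁
      obtain ⟨u, hu, huT, hc⟩ := hS.exists_diff_singleton hRv (T := Insert.insert v R)
        ⟨by rw [hQR]; exact Set.insert_subset_insert Set.subset_union_right, fun h => by
          rcases h (by rw [hQR]; exact Or.inr (Or.inl hq₀)) with h | h
          exacts [hq₀v h, hdisj q₀ h hq₀]⟩ ⟨v, Or.inl rfl⟩
      have huv : u ≠ v := fun e => huT (Or.inl e)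
      have hru : r ≠ u := fun e => huT (Or.inr (e ▸ hr))
      obtain ⟨x, hx, hxu, hxv⟩ : ∃ x ∈ Q, x ≠ u ∧ ¬ F.Adj x v := by
        by_cases hu₀ : q₀ = u
        · exact ⟨q₁, hq₁, fun e => hne (e.trans hu₀.symm), hadj₁⟩
        · exact ⟨q₀, hq₀, hu₀, hadj⟩
      exact key u hu huv ⟨x, hx, hxu⟩ ⟨r, hr, hru⟩ ⟨x, hx, hxu, hxv⟩ hc
    -- Otherwise `q₀` has a neighbour `p` in `Q` adjacent to `v`, so `q₀, p, v, r` is a path. Since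
    -- `S` has at least five vertices, one outside the path can be deleted.
    · push Not at hq₁
      obtain ⟨x, -, hxT, p, hp, hpT, hxp⟩ := hS {q₀} ⟨q₀, by rw [hQR]; exact Or.inr (Or.inl hq₀), rfl⟩
        ⟨v, by rw [hQR]; exact Or.inl rfl, hq₀v.symm⟩
      obtain rfl : x = q₀ := hxT
      have hpQ : p ∈ Q := by
        rw [hQR] at hp
        rcases hp with rfl | hp | hp
        exacts [absurd hxp hadj, hp, absurd hxp (hno x hq₀ p hp)]
      have hvp : F.Adj p v := hq₁ p hpQ hpT
      have hT : CutConn F {x, p, r, v} :=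
        (((cutConn_singleton v).insert rfl hvr).insert (by simp) hvp.symm).insert (by simp) hxp.symm
      obtain ⟨u, hu, huT, hc⟩ := hS.exists_diff_singleton hT (by
        refine Set.ssubset_iff_subset_ne.2 ⟨?_, ?_⟩
        · rw [hQR]
          rintro z (rfl | rfl | rfl | rfl)
          exacts [Or.inr (Or.inl hq₀), Or.inr (Or.inl hpQ), Or.inr (Or.inr hr), Or.inl rfl]
        · rintro rfl
          have h1 := Set.ncard_insert_le x {p, r, v}
          have h2 := Set.ncard_insert_le p {r, v}
          have h3 := Set.ncard_insert_le r {v}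
          rw [Set.ncard_singleton] at h3
          omega) ⟨x, by simp⟩
      simp only [Set.mem_insert_iff, Set.mem_singleton_iff, not_or] at huT
      exact key u hu huT.2.2.2 ⟨x, hq₀, Ne.symm huT.1⟩ ⟨r, hr, Ne.symm huT.2.2.1⟩
        ⟨x, hq₀, Ne.symm huT.1, hadj⟩ hc

theorem CutCC.compl {S : Set V} (h : CutCC G S) : CutCC Gᶜ S :=
  ⟨h.2, by rw [compl_compl]; exact h.1⟩

theorem CutCC.exists_removable_of_not_cutConn [Finite V] {S : Set V} (h : CutCC F S)
    (hcard : 5 ≤ S.ncard) {v : V} (hv : v ∈ S) (hc : ¬ CutConn F (S \ {v})) :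
    ∃ u ∈ S, CutCC F (S \ {u}) := by
  rw [cutConn_iff_closed] at hc
  push Not at hc
  obtain ⟨T, hT, x, hx, y, hy, hxT, hyT⟩ := hc
  set Q := (S \ {v}) ∩ T with hQ
  set R := (S \ {v}) \ T with hR
  have hQR : S = Insert.insert v (Q ∪ R) := by
    rw [hQ, hR, Set.inter_union_sdiff, Set.insert_sdiff_singleton, Set.insert_eq_of_mem hv]
  have hno : ∀ q ∈ Q, ∀ r ∈ R, ¬ F.Adj q r := fun q hq r hr hadj =>
    hr.2 (hT q hq.1 r hr.1 hadj hq.2)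
  have hdisj : ∀ r ∈ R, r ∉ Q := fun r hr hq => hr.2 hq.2
  have hvQ : v ∉ Q := fun h => h.1.2 rfl
  have hvR : v ∉ R := fun h => h.1.2 rfl
  obtain ⟨a, -, haT, q₀, hq₀, hq₀T, haq⟩ := h.2 {v} ⟨v, hv, rfl⟩ ⟨x, hx.1, hx.2⟩
  obtain rfl : a = v := haT
  have hadj : ¬ F.Adj q₀ a := fun e => haq.2 e.symm
  by_cases hq : q₀ ∈ T
  · exact exists_removable_of_cut h.1 hQR hno hdisj hvQ hvR ⟨y, hy, hyT⟩ ⟨⟨hq₀, hq₀T⟩, hq⟩ hadj hcard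
  · exact exists_removable_of_cut h.1 (by rw [Set.union_comm]; exact hQR)
      (fun r hr q hq hadj => hno q hq r hr hadj.symm) (fun q hq hr => hdisj q hr hq) hvR hvQ
      ⟨x, hx, hxT⟩ ⟨⟨hq₀, hq₀T⟩, hq⟩ hadj hcard

/-- Every complement-connected graph with at least five vertices has a vertex whose removal leaves
a complement-connected graph. -/
theorem CutCC.exists_removable [Finite V] {S : Set V} (h : CutCC G S) (hcard : 5 ≤ S.ncard) :
    ∃ u ∈ S, CutCC G (S \ {u}) := by
  obtain ⟨v, hv⟩ : S.Nonempty := by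
    rw [← Set.ncard_pos (Set.toFinite _)]; omega
  by_cases h1 : CutConn G (S \ {v})
  · by_cases h2 : CutConn Gᶜ (S \ {v})
    · exact ⟨v, hv, h1, h2⟩
    · obtain ⟨u, hu, hc⟩ := h.compl.exists_removable_of_not_cutConn hcard hv h2
      exact ⟨u, hu, by simpa using hc.compl⟩
  · exact h.exists_removable_of_not_cutConn hcard hv h1

/-- This trims an oversized piece of `H` to `c + 1` vertices, few enough to play and too many for a
final piece of `G`. Deletion works from five vertices on, hence `4 ≤ n`. -/
theorem CutCC.exists_subset_ncard_eq [Finite V] {S : Set V} (h : CutCC G S) {n : ℕ} (hn : 4 ≤ n)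
    (hS : n ≤ S.ncard) : ∃ T ⊆ S, CutCC G T ∧ T.ncard = n := by
  induction hk : S.ncard using Nat.strong_induction_on generalizing S with
  | _ k ih =>
  rcases hS.eq_or_lt with rfl | hlt
  · exact ⟨S, subset_rfl, h, rfl⟩
  · obtain ⟨u, hu, hc⟩ := h.exists_removable (by omega)
    have := Set.ncard_sdiff_singleton_of_mem hu
    obtain ⟨T, hT, hT'⟩ := ih (S \ {u}).ncard (by omega) hc (by omega) rfl
    exact ⟨T, hT.trans Set.sdiff_subset, hT'⟩

end Removal

/-! ### Spoiler's strategy -/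

section Strategy

variable {V W : Type*} {G : SimpleGraph V} {H : SimpleGraph W}

/-- `G` is connected and decomposes uniformly in `K` steps into complement-connected pieces with at
most `c` vertices, where siblings are not isomorphic and the pieces at each step form an antichain
with respect to embeddability. -/
structure Layered (G : SimpleGraph V) (K c : ℕ) : Prop where
  connected : ∀ x y, decRel G 1 x y
  antichain : ∀ j, 1 ≤ j → j ≤ K → ∀ a b,
    Emb G G (cls G j a) (cls G j b) → Emb G G (cls G j b) (cls G j a)
  siblings : ∀ j, 1 ≤ j → j < K → ∀ a b, decRel G j a b →
    Emb G G (cls G (j + 1) a) (cls G (j + 1) b) → decRel G (j + 1) a b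
  separated : ∀ j, 1 ≤ j → j < K → ∀ a, ∃ z, decRel G j a z ∧ ¬ decRel G (j + 1) a z
  cc : ∀ a, CutCC G (cls G K a)
  card_le : ∀ a, (cls G K a).ncard ≤ c

theorem Layered.regular {K c t : ℕ} (h : Layered G K c) (ht : 1 ≤ t)
    (hanti : ∀ y j, t < j → j ≤ K → ∀ b : W, Emb G H (cls G j y) (cls H j b) →
      Emb H G (cls H j b) (cls G j y)) (a : V) : Regular G H K c t a where
  antichain y _ := hanti y
  siblings y _ j hj hjK := h.siblings j (ht.trans hj) hjK y
  separated y _ j hj hjK := h.separated j (ht.trans hj) hjK y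
  cc y _ := h.cc y
  card_le y _ := h.card_le y

theorem cls_zero_emb (a b : V) : Emb G G (cls G 0 a) (cls G 0 b) := by
  rw [cls_zero, cls_zero]
  exact Emb.refl _

theorem Layered.antichain' {K c : ℕ} (h : Layered G K c) {j : ℕ} (hj : j ≤ K) {a b : V}
    (hE : Emb G G (cls G j a) (cls G j b)) : Emb G G (cls G j b) (cls G j a) := by
  rcases Nat.eq_zero_or_pos j with rfl | h0
  · exact cls_zero_emb b a
  · exact h.antichain j h0 hj a b hE

/-- Otherwise the class at step `j` would be complement-connected, and no later step could split it.
-/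
theorem exists_separated {l : ℕ} {x y : V} (h : decRel G l x y) (h' : ¬ decRel G (l + 1) x y)
    {j : ℕ} (hj : 1 ≤ j) (hjl : j ≤ l) : ∃ z, decRel G j x z ∧ ¬ decRel G (j + 1) x z := by
  by_contra! hc
  obtain ⟨i, rfl⟩ : ∃ i, j = i + 1 := ⟨j - 1, by omega⟩
  have hcc : CutCC G (cls G (i + 1) x) := cutCC_cls_of_eq fun z hz => hc z hz
  exact h' (hcc.subset_cls (self_mem_cls _ _) (l + 1) (decRel_of_le hjl h))

variable [Finite V] [Finite W] [Nonempty V]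

/-- If pieces of `G` embed only into isomorphic pieces of `H`, then Spoiler wins in `G`. -/
theorem Layered.not_survives_of_forall [Nonempty W] {K c : ℕ} (h : Layered G K c) (hK : 1 ≤ K)
    (hiso : ¬ Nonempty (G ≃g H))
    (hgood : ∀ j ≤ K, ∀ (a : V) (b : W), Emb G H (cls G j a) (cls H j b) →
      Emb H G (cls H j b) (cls G j a)) (hS : Survives G H (K + c) ∅) : False := by
  have hE : ¬ Emb G H Set.univ Set.univ := by
    rintro ⟨f, hf, hfS⟩
    have hb := hgood 0 (Nat.zero_le _) (Classical.arbitrary V) (Classical.arbitrary W)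
    rw [cls_zero, cls_zero] at hb
    have him := hf.image_eq hfS (hb ⟨f, hf, hfS⟩)
    refine hiso ⟨⟨Equiv.ofBijective f ⟨fun x y => (hf x trivial y trivial).1.2, fun y => ?_⟩, ?_⟩⟩
    · obtain ⟨x, -, hx⟩ : y ∈ f '' Set.univ := him ▸ trivial
      exact ⟨x, hx⟩
    · intro x y
      exact (hf x trivial y trivial).2.symm
  obtain ⟨b, hS'⟩ := hS.play (s := K + c - 1) (by omega) (Classical.arbitrary V)
  refine not_survives_of_not_emb (t := 1) (s := 1) (h.regular le_rfl
    (fun y j _ hj b => hgood j hj y b) _) hS' (Set.mem_insert _ _) (confined_one _ _ _) le_rfl hK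
    (by omega) (fun hE' => hE ?_) (by omega)
  refine hE'.mono (fun x _ => h.connected _ x) (Set.subset_univ _)

/-- If a final piece of `G` embeds properly into a piece of `H` of the same depth, then Spoiler
wins in `H`. -/
theorem Layered.not_survives_of_top {K c : ℕ} (h : Layered G K c) (hK : 1 ≤ K) (hc : 3 ≤ c)
    {g : V} {x : W} (hE : Emb G H (cls G K g) (cls H K x))
    (hE' : ¬ Emb H G (cls H K x) (cls G K g)) (hS : Survives H G (K + c) ∅) : False := by
  by_cases hcc : CutCC H (cls H K x)
  · rcases le_or_gt (cls H K x).ncard c with hcard | hcard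
    · obtain ⟨f, -, hf, hfS⟩ := hS.play_cc (s := 0) hcc (by omega)
      have hx : Emb H G (cls H K x) (cls G K (f x)) := ⟨f, hf, hfS x (self_mem_cls _ _) K⟩
      exact hE' (hx.trans (h.antichain K hK le_rfl _ _ (hE.trans hx)))
    · obtain ⟨T, -, hTcc, hTc⟩ := hcc.exists_subset_ncard_eq (n := c + 1) (by omega) hcard
      obtain ⟨f, -, hf, hfS⟩ := hS.play_cc (s := 0) hTcc (by omega)
      obtain ⟨t, ht⟩ : T.Nonempty := by rw [← Set.ncard_pos (Set.toFinite _)]; omega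
      have hT : Emb H G T (cls G K (f t)) := ⟨f, hf, hfS t ht K⟩
      have := hT.ncard_le.trans (h.card_le _)
      omega
  · obtain ⟨φ, hφ, hφx⟩ := hE
    set C := φ '' cls G K g with hC
    have hCcc : CutCC H C := hφ.cutCC (h.cc g)
    set a := φ g with ha
    have haC : a ∈ C := ⟨g, self_mem_cls _ _, rfl⟩
    have hcls : cls H K x = cls H K a := cls_eq (hφx haC)
    obtain ⟨k, rfl⟩ : ∃ k, K = k + 1 := ⟨K - 1, by omega⟩
    obtain ⟨z, hz, hz'⟩ : ∃ z, decRel H (k + 1) a z ∧ ¬ decRel H (k + 2) a z := by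
      by_contra! hcon
      refine hcc ?_
      rw [hcls]
      exact cutCC_cls_of_eq fun z hz => hcon z hz
    have hCcard : C.ncard ≤ c := by
      rw [hC, hφ.injOn.ncard_image]; exact h.card_le g
    -- The answers to `C` fill a whole final piece of `G`, so `z` must be answered outside it, which
    -- separates too early. The cost is at most `c` rounds for `C`, one for `z` and `K - 1` for the
    -- early separation.
    obtain ⟨f, hS', hf, hfS⟩ := hS.play_cc (s := k + 1) hCcc (by omega)
    have hCE : Emb G G (cls G (k + 1) g) (cls G (k + 1) (f a)) :=
      (hφ.emb_image).trans ⟨f, hf, hfS a haC _⟩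
    have himg : f '' C = cls G (k + 1) (f a) :=
      hf.image_eq (hfS a haC _) ((h.antichain _ hK le_rfl _ _ hCE).trans hφ.emb_image)
    obtain ⟨w, hS''⟩ := hS'.play le_rfl z
    have hmem : ∀ s ∈ C, (s, f s) ∈ insert (z, w) (∅ ∪ (fun x => (x, f x)) '' C) :=
      fun s hs => Or.inr (Or.inr ⟨s, hs, rfl⟩)
    have hw : ¬ decRel G (k + 1) (f a) w := by
      intro hw
      obtain ⟨s, hs, hsw⟩ : w ∈ f '' C := himg ▸ hw
      have : s = z := (hS''.consistent.eq_iff (hmem s hs) (Set.mem_insert _ _)).2 hsw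
      exact hz' (hCcc.subset_cls haC (k + 2) (this ▸ hs))
    obtain ⟨n, hn, h1, h2⟩ := exists_separation hw
    exact not_survives_of_early_separation hS'' (confined_one _ _ _) (hmem a haC)
      (Set.mem_insert _ _) hK hz hz' h1 h2 hn
      (fun j hj hjk => exists_separated hz hz' hj hjk.le) le_rfl

/-- If a piece of `G` that is not final embeds properly into a piece of `H` of the same depth, and
this does not happen at greater depth, then Spoiler wins in `H`. -/
theorem Layered.not_survives_of_lt {K c l : ℕ} (h : Layered G K c) (hc : 1 ≤ c)
    (hl : l < K) {g : V} {x₀ : W} (hE : Emb G H (cls G l g) (cls H l x₀))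
    (hE' : ¬ Emb H G (cls H l x₀) (cls G l g))
    (hgood : ∀ j, l < j → j ≤ K → ∀ (a : V) (b : W), Emb G H (cls G j a) (cls H j b) →
      Emb H G (cls H j b) (cls G j a)) (hS : Survives H G (K + c) ∅) : False := by
  obtain ⟨φ, hφ, hφx⟩ := hE
  have hφ₁ : ∀ y ∈ cls G l g, IndMap G H φ (cls G (l + 1) y) := fun y hy =>
    hφ.mono (by rw [cls_eq hy]; exact cls_subset (Nat.le_succ l) y)
  -- Deeper embeddings are isomorphisms, so the copy of the piece of `G` is a union of whole
  -- components with the same decomposition.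
  have hφcls : ∀ y ∈ cls G l g, ∀ j, l < j → j ≤ K → φ '' cls G j y = cls H j (φ y) := by
    intro y hy j hj _
    have hsub := hφ.image_cls_subset hφx (Nat.le_succ l) hy
    exact (hφ₁ y hy).image_cls ((hφ₁ y hy).image_eq hsub
      (hgood (l + 1) (by omega) (by omega) y (φ y) ⟨φ, hφ₁ y hy, hsub⟩)) hj (self_mem_cls _ _)
  have hmap : ∀ y ∈ cls G l g, ∀ j, l < j → j ≤ K → IndMap G H φ (cls G j y) :=
    fun y hy j hj _ => (hφ₁ y hy).mono (cls_subset hj y)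
  have hGH : ∀ y ∈ cls G l g, ∀ j, l < j → j ≤ K → Emb G H (cls G j y) (cls H j (φ y)) :=
    fun y hy j hj hjK => ⟨φ, hmap y hy j hj hjK, (hφcls y hy j hj hjK).subset⟩
  have hHG : ∀ y ∈ cls G l g, ∀ j, l < j → j ≤ K → Emb H G (cls H j (φ y)) (cls G j y) := by
    intro y hy j hj hjK
    rw [← hφcls y hy j hj hjK]
    exact (hmap y hy j hj hjK).emb_symm
  obtain ⟨x, hx, hxφ⟩ : ∃ x ∈ cls H l x₀, x ∉ φ '' cls G l g := by
    by_contra! hcon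
    refine hE' ?_
    rw [← Set.Subset.antisymm hφx hcon]
    exact hφ.emb_symm
  have hxl : ∀ y ∈ cls G l g, decRel H l x (φ y) := fun y hy =>
    decRel_trans (decRel_symm hx) (hφx ⟨y, hy, rfl⟩)
  have hxl' : ∀ y ∈ cls G l g, ¬ decRel H (l + 1) x (φ y) := by
    intro y hy hxy
    obtain ⟨z, hz, hzx⟩ : x ∈ φ '' cls G (l + 1) y := by
      rw [hφcls y hy (l + 1) (by omega) (by omega)]; exact decRel_symm hxy
    exact hxφ ⟨z, decRel_trans hy (decRel_of_succ hz), hzx⟩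
  -- The structure of `G` transfers along `φ`, so Spoiler can descend in `H` inside the copy.
  have hreg : ∀ y ∈ cls G l g, Regular H G K c (l + 1) (φ y) := by
    intro y hy
    have hpre : ∀ z, decRel H (l + 1) (φ y) z → ∃ y' ∈ cls G l g, φ y' = z := by
      intro z hz
      obtain ⟨y', hy', rfl⟩ : z ∈ φ '' cls G (l + 1) y := by
        rw [hφcls y hy (l + 1) (by omega) (by omega)]; exact hz
      exact ⟨y', decRel_trans hy (decRel_of_succ hy'), rfl⟩
    refine ⟨?_, ?_, ?_, ?_, ?_⟩ <;> intro z hz <;> obtain ⟨y', hy', rfl⟩ := hpre z hz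
    · intro j hj hjK b hb
      exact (h.antichain j (by omega) hjK _ _ ((hGH y' hy' j (by omega) hjK).trans hb)).trans
        (hGH y' hy' j (by omega) hjK)
    · intro j hj hjK z' hz' hzE
      obtain ⟨y'', hy'', rfl⟩ : z' ∈ φ '' cls G j y' := by
        rw [hφcls y' hy' j (by omega) (by omega)]; exact hz'
      have hyl : y'' ∈ cls G l g := decRel_trans hy' (decRel_of_le (by omega) hy'')
      have := h.siblings j (by omega) hjK y' y'' hy''
        (((hGH y' hy' (j + 1) (by omega) hjK).trans hzE).trans (hHG y'' hyl (j + 1) (by omega) hjK))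
      exact (hφcls y' hy' (j + 1) (by omega) hjK).subset ⟨y'', this, rfl⟩
    · intro j hj hjK
      obtain ⟨z, hz, hz'⟩ := h.separated j (by omega) hjK y'
      refine ⟨φ z, (hφcls y' hy' j (by omega) hjK.le).subset ⟨z, hz, rfl⟩, fun hn => ?_⟩
      obtain ⟨z₁, hz₁, he⟩ : φ z ∈ φ '' cls G (j + 1) y' := by
        rw [hφcls y' hy' (j + 1) (by omega) hjK]; exact hn
      have := (hmap y' hy' j (by omega) hjK.le).injOn (decRel_of_succ hz₁) hz he
      exact hz' (this ▸ hz₁)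
    · rw [← hφcls y' hy' K hl le_rfl]
      exact (hmap y' hy' K hl le_rfl).cutCC (h.cc y')
    · rw [← hφcls y' hy' K hl le_rfl, (hmap y' hy' K hl le_rfl).injOn.ncard_image]
      exact h.card_le y'
  obtain ⟨x', hS₁⟩ := hS.play (s := K + c - 1) (by omega) x
  have hearly : ∀ {r P y w}, y ∈ cls G l g → Survives H G r P → (x, x') ∈ P → (φ y, w) ∈ P →
      l ≤ r + 1 → decRel G l x' w := by
    intro r P y w hy hSP hxP hyP hr
    rcases Nat.eq_zero_or_pos l with rfl | hl0
    · trivial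
    by_contra hn
    obtain ⟨n, hn, h1, h2⟩ := exists_separation hn
    exact not_survives_of_early_separation hSP (confined_one _ _ _) hxP hyP hl0 (hxl y hy)
      (hxl' y hy) h1 h2 hn (fun j hj hjl => exists_separated (hxl y hy) (hxl' y hy) hj hjl.le) hr
  have hxP : (x, x') ∈ insert (x, x') (∅ : Set (W × V)) := Set.mem_insert _ _
  -- If the piece of `x'` is isomorphic to that of `g`, let `m` be the counterpart of `x'`. Only the
  -- component of `x'` can then accommodate that of `m`, yet `x` lies outside the component of `φ
  -- m`.
  by_cases hM : Emb G G (cls G l g) (cls G l x')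
  · obtain ⟨ψ, hψ, hψx⟩ := id hM
    have hψim := hψ.image_eq hψx (h.antichain' hl.le hM)
    obtain ⟨m, hm, hmx⟩ : x' ∈ ψ '' cls G l g := hψim ▸ self_mem_cls l x'
    have hmj : ∀ j, l ≤ j → Emb G G (cls G j x') (cls G j m) := by
      intro j hj
      have := hψ.image_cls hψim hj hm
      rw [← hmx, ← this]
      refine (hψ.mono ?_).emb_symm
      rw [cls_eq hm]; exact cls_subset hj m
    have hmj' : ∀ j, l ≤ j → j ≤ K → Emb G G (cls G j m) (cls G j x') :=
      fun j hj hjK => h.antichain' hjK (hmj j hj)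
    have hsib : ∀ w, decRel G l x' w → ∀ y, decRel G (l + 1) m y →
        Emb G G (cls G (l + 1) y) (cls G (l + 1) w) → decRel G (l + 1) x' w := by
      intro w hw y hy hyw
      rcases Nat.eq_zero_or_pos l with rfl | hl0
      · exact h.connected _ _
      · refine h.siblings l hl0 hl _ _ hw ((hmj (l + 1) (by omega)).trans ?_)
        rwa [cls_eq hy]
    rcases Nat.lt_or_ge (l + 1) K with hlK | hlK
    · obtain ⟨y, hy, hy'⟩ := h.separated (l + 1) (by omega) hlK m
      have hyg : y ∈ cls G l g := decRel_trans hm (decRel_of_succ hy)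
      obtain ⟨w, hS₂⟩ := hS₁.play (s := K + c - 2) (by omega) (φ y)
      have hxP' := Set.mem_insert_of_mem (φ y, w) hxP
      have hyP := Set.mem_insert (φ y, w) (insert (x, x') (∅ : Set (W × V)))
      have hw := hearly hyg hS₂ hxP' hyP (by omega)
      have hconf := confined_of_separated (G := H) (H := G) hxP' (hxl y hyg) (hxl' y hyg) hw
      by_cases hw1 : decRel G (l + 1) x' w
      -- The separation of `x` from `φ y` has the parity of `l`, which forbids separating `x'` from
      -- `w` at step `l + 1`. So `w` lies in the copy of the class of `m`, into which its sibling,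
      -- the class of `y`, does not embed.
      · have hw2 : decRel G (l + 2) x' w := by
          by_contra hn
          have := hS₂.consistent.odd_iff hxP' hyP (hxl y hyg) (hxl' y hyg) hw1 hn
          rw [Nat.odd_add_one] at this
          tauto
        refine not_survives_of_not_emb (s := l + 2) (hreg y hyg) hS₂ hyP hconf (by omega)
          (by omega) (by omega) (fun hyw => hy' ?_) (by omega)
        refine decRel_symm (h.siblings (l + 1) (by omega) hlK _ _ (decRel_symm hy) ?_)
        refine (hGH y hyg (l + 2) (by omega) hlK).trans (hyw.trans ?_)
        rw [← cls_eq hw2]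
        exact hmj (l + 2) (by omega)
      · refine not_survives_of_not_emb (s := l + 1) (hreg y hyg) hS₂ hyP hconf le_rfl
          (by omega) (by omega) (fun hyw => hw1 ?_) ?_
        · exact hsib w hw y hy ((hGH y hyg (l + 1) (by omega) hlK.le).trans hyw)
        -- For `l = 0` connectedness of `G` excludes this case; `l ≥ 1` leaves just enough rounds.
        · have : l ≠ 0 := by
            rintro rfl; exact hw1 (h.connected _ _)
          omega
    · obtain rfl : K = l + 1 := by omega
      have hcard : (cls H (l + 1) (φ m)).ncard ≤ c := (hreg m hm).card_le _ (decRel_refl _ _)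
      -- The component of `φ m` is now a final piece. The answers to it fill the piece of `x'` and
      -- so use `x'` itself, although `x` was not played again.
      obtain ⟨f, hS₂, hf, hfS⟩ := hS₁.play_cc (s := l) ((hreg m hm).cc _ (decRel_refl _ _))
        (by omega)
      have hφm : φ m ∈ cls H (l + 1) (φ m) := self_mem_cls _ _
      have hfE : Emb H G (cls H (l + 1) (φ m)) (cls G (l + 1) (f (φ m))) := ⟨f, hf, hfS _ hφm _⟩
      have hmE := (hGH m hm (l + 1) (by omega) le_rfl).trans hfE
      have him := hf.image_eq (hfS _ hφm (l + 1))
        ((h.antichain' le_rfl hmE).trans (hGH m hm (l + 1) (by omega) le_rfl))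
      have hw := hearly hm hS₂ (Or.inl hxP) (Or.inr ⟨φ m, hφm, rfl⟩) (by omega)
      obtain ⟨s, hs, hsx⟩ : x' ∈ f '' cls H (l + 1) (φ m) := by
        rw [him]
        exact decRel_symm (hsib _ hw m (decRel_refl _ _) hmE)
      have : x = s := (hS₂.consistent.eq_iff (Or.inl hxP) (Or.inr ⟨s, hs, rfl⟩)).2 hsx.symm
      exact hxl' m hm (decRel_symm (this ▸ hs))
  · have hl0 : 1 ≤ l := by
      rcases Nat.eq_zero_or_pos l with rfl | hl0
      exacts [absurd (cls_zero_emb _ _) hM, hl0]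
    -- Some component of the piece of `g` embeds into no component of the piece of `x'`; the descent
    -- starts in its copy.
    obtain ⟨y, hy, hyE⟩ := (h.regular (H := G) hl0 (fun y j _ hjK b => h.antichain' hjK)
      g).exists_component (decRel_refl _ _) le_rfl hl hM
    obtain ⟨w, hS₂⟩ := hS₁.play (s := K + c - 2) (by omega) (φ y)
    have hxP' := Set.mem_insert_of_mem (φ y, w) hxP
    have hyP := Set.mem_insert (φ y, w) (insert (x, x') (∅ : Set (W × V)))
    have hw := hearly hy hS₂ hxP' hyP (by omega)
    exact not_survives_of_not_emb (s := l + 1) (hreg y hy) hS₂ hyP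
      (confined_of_separated hxP' (hxl y hy) (hxl' y hy) hw) le_rfl (by omega) (by omega)
      (fun hE => hyE w hw ((hGH y hy (l + 1) (by omega) hl).trans hE)) (by omega)

/-- Downward induction on depth: the deepest proper embedding of a piece of `G` gives a win in `H`,
and its absence gives a win in `G`. -/
theorem Layered.not_survives [Nonempty W] {K c : ℕ} (h : Layered G K c) (hK : 1 ≤ K) (hc : 3 ≤ c)
    (hiso : ¬ Nonempty (G ≃g H)) (hS : Survives G H (K + c) ∅) (hS' : Survives H G (K + c) ∅) :
    False := by
  have key : ∀ n ≤ K + 1, ∀ j, K + 1 - n ≤ j → j ≤ K → ∀ (a : V) (b : W),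
      Emb G H (cls G j a) (cls H j b) → Emb H G (cls H j b) (cls G j a) := by
    intro n
    induction n with
    | zero => intro _ j hj hjK; omega
    | succ n ih =>
      intro hn j hj hjK a b hE
      by_contra hE'
      have hgood : ∀ i, j < i → i ≤ K → _ := fun i hi hiK => ih (by omega) i (by omega) hiK
      rcases hjK.eq_or_lt with rfl | hlt
      · exact h.not_survives_of_top hK hc hE hE' hS'
      · exact h.not_survives_of_lt (by omega) hlt hE hE' hgood hS'
  exact h.not_survives_of_forall hK hiso (fun j hj => key (K + 1) le_rfl j (by omega) hj) hS

end Strategy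

/-! ### Uniform inclusion-free graphs -/

section Rank

theorem reflTransGen_lift {α β : Type*} {r : α → α → Prop} {p : β → β → Prop} (f : α → β)
    (h : ∀ a b, r a b → p (f a) (f b)) {x y : α} (hxy : Relation.ReflTransGen r x y) :
    Relation.ReflTransGen p (f x) (f y) := by
  induction hxy with
  | refl => exact .refl
  | tail _ hbc ih => exact ih.tail (h _ _ hbc)

theorem level_compl_induce {V : Type*} (G : SimpleGraph V) (S : Set V) (j : ℕ) :
    level (Gᶜ.induce S) j = (level G (j + 1)).induce S := by
  induction j with
  | zero => rfl
  | succ j ih =>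
    change (level (Gᶜ.induce S) j)ᶜ = _
    rw [ih, compl_induce]; rfl

theorem decRel_one_of_connected {V : Type*} {G : SimpleGraph V} (hG : G.Connected) (x y : V) :
    decRel G 1 x y := by
  exact reflTransGen_lift id (fun a b hab => ⟨trivial, hab⟩)
    ((SimpleGraph.reachable_iff_reflTransGen _ _).1 (hG.preconnected x y))

theorem reachable_compl_of_decRel_two {V : Type*} {G : SimpleGraph V} {x y : V}
    (h : decRel G 2 x y) : Gᶜ.Reachable x y :=
  (SimpleGraph.reachable_iff_reflTransGen _ _).2 (reflTransGen_lift id (fun _ _ h => h.2) h)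

/-- The decomposition of a connected component of the complement of a connected graph. -/
theorem decRel_component_iff {V : Type*} {G : SimpleGraph V} (hG : G.Connected)
    (C : Gᶜ.ConnectedComponent) (j : ℕ) (x y : C) :
    decRel C.toSimpleGraph j x y ↔ decRel G (j + 1) x y := by
  induction j generalizing x y with
  | zero => exact iff_of_true trivial (decRel_one_of_connected hG x y)
  | succ j ih =>
    have hstep : ∀ a b : C, (decRel C.toSimpleGraph j a b ∧ (level C.toSimpleGraph j).Adj a b) ↔
        (decRel G (j + 1) a b ∧ (level G (j + 1)).Adj a b) := by
      intro a b
      rw [ih, show C.toSimpleGraph = Gᶜ.induce C.supp from rfl, level_compl_induce]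
      rfl
    constructor
    · exact reflTransGen_lift Subtype.val fun a b hab => (hstep a b).1 hab
    · obtain ⟨y, hy⟩ := y
      intro h
      change Relation.ReflTransGen _ (x : V) y at h
      induction h with
      | refl => exact decRel_refl _ _
      | @tail b c hb hbc ihb =>
        have hbC : b ∈ C.supp := by
          have h2 : decRel G 2 x b := decRel_of_le (i := 2) (j := j + 1 + 1) (by omega) hb
          have hx : Gᶜ.connectedComponentMk x = C := x.2
          rw [SimpleGraph.ConnectedComponent.mem_supp_iff, ← hx]
          exact (SimpleGraph.ConnectedComponent.sound (reachable_compl_of_decRel_two h2)).symm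
        exact Relation.ReflTransGen.tail (ihb hbC) ((hstep ⟨b, hbC⟩ ⟨c, hy⟩).2 hbc)

/-- Passing to a component of the complement removes one decomposition step and lowers the rank by
at least one. -/
theorem le_rk_of_separated {V : Type u} [Finite V] {G : SimpleGraph V} (hG : G.Connected) {n : ℕ}
    {a x : V} (h : decRel G n a x) (h' : ¬ decRel G (n + 1) a x) : n ≤ rk G := by
  induction n generalizing V with
  | zero => exact Nat.zero_le _
  | succ n ih =>
    have hGc : ¬ Gᶜ.Connected := by
      intro hGc
      have : CutCC G Set.univ := by
        have hp : ∀ F : SimpleGraph V, F.Connected → CutConn F Set.univ := by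
          intro F hF
          rw [cutConn_iff_preconnected]
          exact (SimpleGraph.induceUnivIso F).preconnected_iff.2 hF.preconnected
        exact ⟨hp G hG, hp _ hGc⟩
      exact h' (this.subset_cls (Set.mem_univ a) (n + 1 + 1) (Set.mem_univ x))
    rw [rk, dif_pos hG, dif_neg hGc, rk, dif_neg hGc]
    rcases Nat.eq_zero_or_pos n with rfl | hn
    · omega
    let C := Gᶜ.connectedComponentMk a
    have hx : x ∈ C.supp := (SimpleGraph.ConnectedComponent.sound (reachable_compl_of_decRel_two
      (decRel_of_le (i := 2) (by omega) h))).symm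
    have hC : n ≤ rk C.toSimpleGraph :=
      ih (V := C) (a := ⟨a, rfl⟩) (x := ⟨x, hx⟩) C.connected_toSimpleGraph
        ((decRel_component_iff hG C n _ _).2 h) (fun h => h' ((decRel_component_iff hG C _ _ _).1 h))
    have := le_ciSup (f := fun C : Gᶜ.ConnectedComponent => rk C.toSimpleGraph)
      (Set.finite_range _).bddAbove C
    have := hC.trans this
    omega

end Rank

/-! ### Classes as members of the decomposition -/

section Dec

variable {V : Type u} {G : SimpleGraph V}

theorem reachable_induce_cls_iff {i : ℕ} {a : V} (x y : cls G i a) :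
    ((level G i).induce (cls G i a)).Reachable x y ↔ decRel G (i + 1) x y := by
  rw [SimpleGraph.reachable_iff_reflTransGen]
  constructor
  · exact reflTransGen_lift Subtype.val fun b c hbc =>
      ⟨decRel_trans (decRel_symm b.2) c.2, hbc⟩
  · obtain ⟨y, hy⟩ := y
    intro h
    change Relation.ReflTransGen _ (x : V) y at h
    induction h with
    | refl => exact .refl
    | @tail b c _ hbc ih =>
      have hb : b ∈ cls G i a := decRel_trans hy (decRel_symm hbc.1)
      exact (ih hb).tail hbc.2

theorem cls_succ_mem_componentSets (i : ℕ) (a : V) :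
    cls G (i + 1) a ∈ componentSets (level G i) (cls G i a) := by
  refine ⟨((level G i).induce (cls G i a)).connectedComponentMk ⟨a, self_mem_cls _ _⟩, ?_⟩
  ext x
  constructor
  · intro hx
    refine ⟨⟨x, decRel_of_succ hx⟩, ?_, rfl⟩
    exact SimpleGraph.ConnectedComponent.sound ((reachable_induce_cls_iff _ _).2 (decRel_symm hx))
  · rintro ⟨y, hy, rfl⟩
    exact decRel_symm ((reachable_induce_cls_iff _ _).1 (SimpleGraph.ConnectedComponent.exact hy))

theorem cls_mem_decSets (i : ℕ) (a : V) : cls G (i + 1) a ∈ decSets G i := by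
  induction i with
  | zero =>
    have := cls_succ_mem_componentSets (G := G) 0 a
    rwa [cls_zero] at this
  | succ i ih => exact Set.mem_biUnion ih (cls_succ_mem_componentSets (i + 1) a)

theorem emb_of_embedding {i : ℕ} {S T : Set V}
    (e : (level G i).induce S ↪g (level G i).induce T) : Emb G G S T := by
  classical
  refine ⟨fun x => if h : x ∈ S then e ⟨x, h⟩ else x, ?_, ?_⟩
  · intro x hx y hy
    simp only [hx, hy, dif_pos]
    have hinj : x = y ↔ ((e ⟨x, hx⟩ : T) : V) = (e ⟨y, hy⟩ : T) := by
      rw [← Subtype.ext_iff, e.injective.eq_iff, Subtype.mk_eq_mk]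
    refine ⟨hinj, ?_⟩
    by_cases hxy : x = y
    · subst hxy; simp
    · have h : (level G i).Adj (e ⟨x, hx⟩ : T) (e ⟨y, hy⟩ : T) ↔ (level G i).Adj x y :=
        e.map_rel_iff (a := ⟨x, hx⟩) (b := ⟨y, hy⟩)
      rw [level_adj G hxy, level_adj G (hinj.not.1 hxy)] at h
      tauto
  · rintro _ ⟨x, hx, rfl⟩
    simp [hx]

theorem IndMap.nonempty_embedding {f : V → V} {S T : Set V} (hf : IndMap G G f S) (h : f '' S ⊆ T)
    (i : ℕ) : Nonempty ((level G i).induce S ↪g (level G i).induce T) := by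
  refine ⟨⟨⟨fun x => ⟨f x, h ⟨x, x.2, rfl⟩⟩, fun x y hxy => ?_⟩, ?_⟩⟩
  · exact Subtype.ext (hf.injOn x.2 y.2 (congrArg Subtype.val hxy))
  · intro x y
    exact (hf.level_adj x.2 y.2 i).symm

theorem compConnected_level_of_cutCC {S : Set V} (h : CutCC G S) (hS : S.Nonempty) (i : ℕ) :
    CompConnected ((level G i).induce S) := by
  rw [compConnected_induce_iff]
  exact ⟨hS, h.level i, h.level (i + 1)⟩

/-- Inclusion-freeness yields the antichain and sibling conditions, uniformity the separations. No
separation occurs after step `rk G`, so the classes at step `rk G + 1` are complement-connected and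
maximal, that is, cocomponents. -/
theorem layered [Finite V] (hconn : G.Connected) (huniform : IsUniform G)
    (hfree : IsInclusionFree G) {c : ℕ} (hcoc : ∀ S : Set V, IsCocomponent G S → S.ncard ≤ c) :
    Layered G (rk G + 1) c := by
  have hanti : ∀ j, 1 ≤ j → j ≤ rk G + 1 → ∀ a b,
      Emb G G (cls G j a) (cls G j b) → Emb G G (cls G j b) (cls G j a) := by
    rintro j hj hjK a b ⟨f, hf, hfS⟩
    obtain ⟨i, rfl⟩ : ∃ i, j = i + 1 := ⟨j - 1, by omega⟩
    obtain ⟨e⟩ := (hfree i (by omega)).2 _ (cls_mem_decSets i a) _ (cls_mem_decSets i b)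
      (hf.nonempty_embedding hfS i)
    exact emb_of_embedding (i := i) e.symm.toEmbedding
  have hcc : ∀ a, CutCC G (cls G (rk G + 1) a) := by
    refine fun a => cutCC_cls_of_eq fun x hx => ?_
    by_contra hx'
    have := le_rk_of_separated hconn hx hx'
    omega
  refine ⟨decRel_one_of_connected hconn, hanti, ?_, ?_, hcc, fun a => hcoc _ ⟨?_, ?_⟩⟩
  · intro j hj hjK a b hab hE
    have hE' := hanti (j + 1) (by omega) (by omega) a b hE
    obtain ⟨f, hf, hfS⟩ := hE
    have him := hf.image_eq hfS hE'
    obtain ⟨i, rfl⟩ : ∃ i, j = i + 1 := ⟨j - 1, by omega⟩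
    have key := (hfree i (by omega)).1 _ (cls_mem_decSets i a)
    have hcompl : (decGraph G i (cls G (i + 1) a))ᶜ =
        (level G (i + 1)).induce (cls G (i + 1) a) := compl_induce _ _
    rw [hcompl] at key
    have hb : b ∈ cls G (i + 1) a := hab
    have ha := self_mem_cls (G := G) (i + 1) a
    let A := (level G (i + 1)).induce (cls G (i + 1) a)
    have hsupp : ∀ {y} (hy : y ∈ cls G (i + 1) a) (x : cls G (i + 1) a),
        x ∈ (A.connectedComponentMk ⟨y, hy⟩).supp ↔ decRel G (i + 2) y x := by
      intro y hy x
      rw [SimpleGraph.ConnectedComponent.mem_supp_iff, SimpleGraph.ConnectedComponent.eq]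
      refine (reachable_induce_cls_iff _ _).trans ⟨decRel_symm, decRel_symm⟩
    have hC := key (A.connectedComponentMk ⟨a, ha⟩) (A.connectedComponentMk ⟨b, hb⟩) ?_
    · exact (reachable_induce_cls_iff _ _).1 (SimpleGraph.ConnectedComponent.exact hC)
    · have hmem : ∀ x, decRel G (i + 2) a x → decRel G (i + 2) b (f x) :=
        fun x hx => hfS ⟨x, hx, rfl⟩
      let φ : (A.connectedComponentMk ⟨a, ha⟩).supp → (A.connectedComponentMk ⟨b, hb⟩).supp :=
        fun x => ⟨⟨f x.1, decRel_trans hb (decRel_of_succ (hmem _ ((hsupp ha _).1 x.2)))⟩,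
          (hsupp hb _).2 (hmem _ ((hsupp ha _).1 x.2))⟩
      have hφ : Function.Bijective φ := by
        constructor
        · intro x y hxy
          refine Subtype.ext (Subtype.ext (hf.injOn ((hsupp ha _).1 x.2) ((hsupp ha _).1 y.2) ?_))
          exact congrArg (fun z => z.1.1) hxy
        · rintro ⟨⟨z, hz⟩, hzb⟩
          obtain ⟨x, hx, hxz⟩ : z ∈ f '' cls G (i + 2) a := him.symm ▸ (hsupp hb _).1 hzb
          exact ⟨⟨⟨x, decRel_of_succ hx⟩, (hsupp ha _).2 hx⟩, Subtype.ext (Subtype.ext hxz)⟩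
      refine ⟨⟨Equiv.ofBijective φ hφ, ?_⟩⟩
      intro x y
      exact (hf.level_adj ((hsupp ha _).1 x.2) ((hsupp ha _).1 y.2) (i + 1)).symm
  · intro j hj hjK a
    by_contra! hc
    obtain ⟨i, rfl⟩ : ∃ i, j = i + 1 := ⟨j - 1, by omega⟩
    have hcc' : CutCC G (cls G (i + 1) a) := cutCC_cls_of_eq fun x hx => hc x hx
    -- An unsplit class is complement-connected and persists to step `rk G`, where it is a member of
    -- `Dec_k` with `k = rk G - 1`, against uniformity.
    obtain ⟨k, hk⟩ : ∃ k, k + 1 = rk G := ⟨rk G - 1, by omega⟩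
    have he : cls G (k + 1) a = cls G (i + 1) a :=
      Set.Subset.antisymm (cls_subset (by omega) a) (hcc'.subset_cls (self_mem_cls _ _) _)
    refine huniform k hk _ (cls_mem_decSets k a) (compConnected_level_of_cutCC ?_ ⟨a, ?_⟩ k)
    · rw [he]; exact hcc'
    · exact self_mem_cls _ _
  · exact compConnected_level_of_cutCC (hcc a) ⟨a, self_mem_cls _ _⟩ 0
  · intro T hT hsub
    rw [compConnected_induce_iff] at hT
    exact CutCC.subset_cls ⟨hT.2.1, hT.2.2⟩ (hsub (self_mem_cls _ a)) _

end Dec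

end LogicalDepth

theorem lemma3p4 {V : Type u} [Finite V] (G : SimpleGraph V) (hconn : G.Connected)
    (huniform : LogicalDepth.IsUniform G) (hfree : LogicalDepth.IsInclusionFree G)
    (c : ℕ) (hc : 5 ≤ c)
    (hcoc : ∀ S : Set V, LogicalDepth.IsCocomponent G S → S.ncard ≤ c) :
    LogicalDepth.altDepth 0 G ≤ ((LogicalDepth.rk G + c + 1 : ℕ) : ℕ∞) := by
  have : Nonempty V := hconn.nonempty
  refine LogicalDepth.altDepth_zero_le G _ fun W _ _ H hiso hS hS' => ?_
  have e : LogicalDepth.rk G + c + 1 = LogicalDepth.rk G + 1 + c := by omega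
  rw [e] at hS hS'
  exact (LogicalDepth.layered hconn huniform hfree hcoc).not_survives (by omega) (by omega) hiso hS hS'
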